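/- Let $U\subseteq\mathbb R^2$ be open with coordinates $(T,R)$, and let $g$ be a smooth Lorentzian metric of signature $(-,+,+,+)$ on $U\times S^2$ that is invariant under the rotation group $SO(3)$ acting on $S^2$ (a spherically symmetric space-time; the orbits are the 2-spheres $\{(T,R)\}\times S^2$). Let $(T,R,\theta,\varphi)$ be the canonical coordinates, where $\theta\in(0,\pi)$ and $\varphi$ are the spherical angles on $S^2$; write $d\Omega^2=d\theta^2+\sin^2\theta\,d\varphi^2$ and $\delta=g_{TT}g_{RR}-g_{TR}^2$. Then the orbits have a radius of curvature, i.e. there is a function $r>0$ on $U$ such that the metric induced on each orbit is $r^2d\Omega^2$. Put $(dr)^2=g^{\mu\nu}\partial_\mu r\,\partial_\nu r$ and let $E=\frac r2\left(1-(dr)^2\right)$ be the Misner-Sharp energy. The following hold. 1. $E\ge 0$ wherever $(dr)^2\le 1$. 2. Let $p\in U$ be a point with $dr\ne0$ and $(dr)^2<1$. Then for some sign $\varepsilon\in\{1,-1\}$ there are, in a neighbourhood of $p$, smooth curvature coordinates $(t,r,\theta,\varphi)$, with $T=T(t,r)$, $R=R(t,r)$ and nonvanishing Jacobian $J=\partial_tT\,\partial_rR-\partial_rT\,\partial_tR$,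 in which $$ds^2=\mathcal A(t,r)\,dt^2+2\,\mathcal B(t,r)\,dt\,dr+dr^2+r^2d\Omega^2,\qquad \mathcal A=J^2\,\delta\,(dr)^2,\qquad \mathcal B=\varepsilon J\sqrt{\delta\left((dr)^2-1\right)}.$$ If moreover $(dr)^2\neq0$ at $p$, such coordinates exist for each of the two signs $\varepsilon=1$ and $\varepsilon=-1$. 3. Let $p\in U$ be a point with $(dr)^2=1$ and suppose that $1-(dr)^2$ is the square of a smooth function in a neighbourhood of $p$ (for example, that $(dr)^2=1$ in a neighbourhood of $p$). Then such coordinates exist in a neighbourhood of $p$, with a sign $\varepsilon=\pm1$ that may depend on the point. 4. In all smooth curvature coordinates with $T=T(t,r)$, $R=R(t,r)$, $J\neq0$, in which $ds^2$ has the form displayed in 2 for some functions $\mathcal A,\mathcal B$, one has $\delta\left((dr)^2-1\right)\ge0$, $\mathcal A=J^2\delta(dr)^2$ and $\mathcal B=\varepsilon J\sqrt{\delta\left((dr)^2-1\right)}$ with $\varepsilon=\pm1$ (possibly depending on the point). -/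

import Mathlib

open Real
open scoped ContDiff RealInnerProductSpace

noncomputable section

/-- Euclidean three-space, in which the unit two-sphere lives. -/
abbrev E3 : Type := EuclideanSpace ℝ (Fin 3)

/-- The unit two-sphere. -/
def unitSphere : Set E3 := Metric.sphere 0 1

/-- A spherically symmetric space-time in a chart `(T, R)` of its orbit space: the manifold
`U × S²` with `U ⊆ ℝ²` open, and a smooth Lorentzian metric of signature `(-,+,+,+)` that is
invariant under the rotation group `SO(3)`, which acts on the factor `S²`; the orbits are the
two-spheres `{(T, R)} × S²`.
The tangent space at `(x, n)` is `{(a, v) ∈ ℝ² × ℝ³ | v ⟂ n}`. The metric at `(x, n)` is given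
as a bilinear form on `ℝ² × ℝ³`, of which only the restriction to the tangent space matters;
smoothness is that of its coefficients. -/
structure SphericalSpacetime where
  U : Set (ℝ × ℝ)
  isOpen_U : IsOpen U
  g : (ℝ × ℝ) × E3 → LinearMap.BilinForm ℝ ((ℝ × ℝ) × E3)
  smooth_g : ∀ u v : (ℝ × ℝ) × E3, ContDiffOn ℝ ∞ (fun q => g q u v) (U ×ˢ unitSphere)
  symm_g : ∀ x ∈ U, ∀ n ∈ unitSphere, ∀ u v : (ℝ × ℝ) × E3,
    ⟪n, u.2⟫ = 0 → ⟪n, v.2⟫ = 0 → g (x, n) u v = g (x, n) v u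
  /-- There is a timelike tangent vector whose orthogonal complement is spacelike. -/
  lorentzian_g : ∀ x ∈ U, ∀ n ∈ unitSphere, ∃ u : (ℝ × ℝ) × E3, ⟪n, u.2⟫ = 0 ∧
    g (x, n) u u < 0 ∧
    ∀ v : (ℝ × ℝ) × E3, ⟪n, v.2⟫ = 0 → v ≠ 0 → g (x, n) u v = 0 → 0 < g (x, n) v v
  /-- Rotations are isometries. -/
  rotation_g : ∀ Q ∈ Matrix.specialOrthogonalGroup (Fin 3) ℝ,
    ∀ x ∈ U, ∀ n ∈ unitSphere, ∀ u v : (ℝ × ℝ) × E3, ⟪n, u.2⟫ = 0 → ⟪n, v.2⟫ = 0 →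
      g (x, Matrix.toEuclideanLin Q n)
        (u.1, Matrix.toEuclideanLin Q u.2) (v.1, Matrix.toEuclideanLin Q v.2) = g (x, n) u v

/-- The point of the unit sphere with polar angle `θ` and azimuth `φ`. -/
def spherePoint (θ φ : ℝ) : E3 := !₂[sin θ * cos φ, sin θ * sin φ, cos θ]

/-- The parametrization `(t, r, θ, φ) ↦ (X (t, r), n (θ, φ))` of the space-time that belongs to
a parametrization `X` of the orbit space. For `X = id` these are the canonical coordinates
`(T, R, θ, φ)`. -/
def coordMap (X : ℝ × ℝ → ℝ × ℝ) (y : Fin 4 → ℝ) : (ℝ × ℝ) × E3 :=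
  (X (y 0, y 1), spherePoint (y 2) (y 3))

/-- The Jacobian determinant `J = Ṫ R' - T' Ṙ` of `X = (T, R)` as a function of `(t, r)`. -/
def jac (X : ℝ × ℝ → ℝ × ℝ) (w : ℝ × ℝ) : ℝ :=
  (fderiv ℝ X w (1, 0)).1 * (fderiv ℝ X w (0, 1)).2
    - (fderiv ℝ X w (0, 1)).1 * (fderiv ℝ X w (1, 0)).2

namespace SphericalSpacetime

variable (S : SphericalSpacetime)

/-- The positive function `r` is the radius of curvature of the orbits: the metric induced on the
orbit over `x` is `r(x)²` times the metric of the unit sphere. -/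
def IsOrbitRadius (r : ℝ × ℝ → ℝ) : Prop :=
  ∀ x ∈ S.U, 0 < r x ∧ ∀ n ∈ unitSphere, ∀ v w : E3, ⟪n, v⟫ = 0 → ⟪n, w⟫ = 0 →
    S.g (x, n) (0, v) (0, w) = r x ^ 2 * ⟪v, w⟫

/-- The matrix of metric components `g_{μν}` in the coordinates given by `coordMap X`. -/
def metricMatrix (X : ℝ × ℝ → ℝ × ℝ) (y : Fin 4 → ℝ) : Matrix (Fin 4) (Fin 4) ℝ :=
  Matrix.of fun μ ν => S.g (coordMap X y)
    (fderiv ℝ (coordMap X) y (Pi.single μ 1)) (fderiv ℝ (coordMap X) y (Pi.single ν 1))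

/-- `δ = A B - C²`, where `A dT² + B dR² + 2 C dT dR` is the `(T, R)` part of the metric in
canonical coordinates, at the point with canonical coordinates `(x, θ, φ)`, `x = (T, R)`. -/
def delta (x : ℝ × ℝ) (θ φ : ℝ) : ℝ :=
  S.metricMatrix id ![x.1, x.2, θ, φ] 0 0 * S.metricMatrix id ![x.1, x.2, θ, φ] 1 1
    - S.metricMatrix id ![x.1, x.2, θ, φ] 0 1 ^ 2

/-- `(dr)² = g^{μν} ∂_μ r ∂_ν r`, computed in canonical coordinates, at the point with canonical
coordinates `(x, θ, φ)`, `x = (T, R)`. -/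
def drSq (r : ℝ × ℝ → ℝ) (x : ℝ × ℝ) (θ φ : ℝ) : ℝ :=
  ∑ μ : Fin 4, ∑ ν : Fin 4, (S.metricMatrix id ![x.1, x.2, θ, φ])⁻¹ μ ν
    * fderiv ℝ (fun y : Fin 4 → ℝ => r (y 0, y 1)) ![x.1, x.2, θ, φ] (Pi.single μ 1)
    * fderiv ℝ (fun y : Fin 4 → ℝ => r (y 0, y 1)) ![x.1, x.2, θ, φ] (Pi.single ν 1)

/-- The Misner-Sharp energy `E = (r / 2) (1 - (dr)²)`. -/
def misnerSharp (r : ℝ × ℝ → ℝ) (x : ℝ × ℝ) (θ φ : ℝ) : ℝ :=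
  r x / 2 * (1 - S.drSq r x θ φ)

/-- `X`, defined on the open set `W`, gives curvature coordinates `(t, r, θ, φ)` (the second
coordinate is the radius of curvature of the orbits) in which
`ds² = 𝒜 dt² + 2 ℬ dt dr + dr² + r² (dθ² + sin² θ dφ²)`. -/
structure IsPGChart (r : ℝ × ℝ → ℝ) (W : Set (ℝ × ℝ)) (X : ℝ × ℝ → ℝ × ℝ)
    (A B : ℝ × ℝ → ℝ) : Prop where
  isOpen : IsOpen W
  mapsTo : Set.MapsTo X W S.U
  smooth : ContDiffOn ℝ ∞ X W
  injOn : Set.InjOn X W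
  jac_ne_zero : ∀ w ∈ W, jac X w ≠ 0
  radius : ∀ w ∈ W, r (X w) = w.2
  metric : ∀ w ∈ W, ∀ θ φ : ℝ, 0 < θ → θ < π →
    S.metricMatrix X ![w.1, w.2, θ, φ] =
      !![A w, B w, 0,       0;
         B w, 1,   0,       0;
         0,   0,   w.2 ^ 2, 0;
         0,   0,   0,       w.2 ^ 2 * sin θ ^ 2]

/-- `𝒜 = J² δ (dr)²` and `ℬ = ε J √(δ ((dr)² - 1))` on the chart, the radicand being
nonnegative. -/
def PGRelations (r : ℝ × ℝ → ℝ) (W : Set (ℝ × ℝ)) (X : ℝ × ℝ → ℝ × ℝ)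
    (A B ε : ℝ × ℝ → ℝ) : Prop :=
  ∀ w ∈ W, ∀ θ φ : ℝ, 0 < θ → θ < π →
    0 ≤ S.delta (X w) θ φ * (S.drSq r (X w) θ φ - 1) ∧
    A w = jac X w ^ 2 * S.delta (X w) θ φ * S.drSq r (X w) θ φ ∧
    B w = ε w * jac X w * √(S.delta (X w) θ φ * (S.drSq r (X w) θ φ - 1))

end SphericalSpacetime

end

/-! Invariance under rotations about the point `n` forces the metric to split as `h + c dΩ²`, with
`h` a metric on the orbit space and `c > 0` depending only on `(T, R)`. Hence `r = √c` is smooth,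
and the Lorentzian signature makes `δ = det h` negative. In particular `δ((dr)² - 1) ≥ 0` exactly
where `(dr)² ≤ 1`.

Where `dr ≠ 0`, the inverse function theorem gives orbit coordinates `(τ, r)`, in which `h = a dτ² +
2b dτ dr + c dr²` (`c` now being the last coefficient). If `J` is their Jacobian, then `a =
J²δ(dr)²` and `ac - b² = J²δ`. Setting `τ = Φ(t, r)` with `∂ᵣΦ = l(Φ, r)` turns the coefficient of
`dr²` into `al² + 2bl + c`. Requiring this to be `1` is a quadratic equation for `l`, whose reduced
discriminant is `b² - a(c - 1) = J²δ((dr)² - 1)`. A smooth square root `d` of it yields a smooth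
`l`, namely `(d - b)/a` or `(1 - c)/(b + d)`, and the flow of `l` yields the chart. The new mixed
coefficient is `Φₜ(al + b) = Φₜd`, which gives the formula for `ℬ`.

If `(dr)² < 1`, both signs of `d` are smooth; where `a = 0` only one of them need keep `b + d ≠ 0`.
If `(dr)² = 1`, the root comes from the assumed root of `1 - (dr)²`, which may change sign. In any
chart of the required form, the two identities with `c = 1` determine `𝒜` and `ℬ²`. -/

section

open Filter Topology Set

/-! ### Smooth flows of time-dependent fields on the line -/

/-- A function on the plane with partial derivatives of class `C^n` is of class `C^(n+1)`. -/
theorem contDiff_succ_of_partial_derivs {G p q : ℝ × ℝ → ℝ} {n : ℕ}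
    (hp : ∀ z : ℝ × ℝ, HasDerivAt (fun x => G (x, z.2)) (p z) z.1)
    (hq : ∀ z : ℝ × ℝ, HasDerivAt (fun s => G (z.1, s)) (q z) z.2)
    (cp : ContDiff ℝ n p) (cq : ContDiff ℝ n q) : ContDiff ℝ (n + 1) G := by
  have key : ∀ z, HasFDerivAt G
      ((ContinuousLinearMap.toSpanSingleton ℝ (p z)).coprod
        (ContinuousLinearMap.toSpanSingleton ℝ (q z))) z := by
    intro z
    have hc : ∀ {f : ℝ × ℝ → ℝ}, ContDiff ℝ n f → ContinuousAt
        (fun v : ℝ × ℝ => ContinuousLinearMap.toSpanSingleton ℝ (f v)) z := by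
      intro f hf
      exact ((ContinuousLinearMap.toSpanSingletonCLE (𝕜 := ℝ) (E := ℝ)).continuous.comp
        hf.continuous).continuousAt
    have := hasStrictFDerivAt_uncurry_coprod (𝕜 := ℝ) (u := z) (f := fun x s => G (x, s))
      (f₁ := fun x s => ContinuousLinearMap.toSpanSingleton ℝ (p (x, s)))
      (f₂ := fun x s => ContinuousLinearMap.toSpanSingleton ℝ (q (x, s)))
      (Eventually.of_forall fun v => (hp v).hasFDerivAt)
      (Eventually.of_forall fun v => (hq v).hasFDerivAt) (hc cp) (hc cq)
    exact this.hasFDerivAt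
  rw [contDiff_succ_iff_fderiv_apply]
  refine ⟨fun z => (key z).differentiableAt, by simp, fun y => ?_⟩
  have : (fun x => fderiv ℝ G x y) = fun x => y.1 * p x + y.2 * q x := by
    funext x
    rw [(key x).fderiv]
    simp
  rw [this]
  fun_prop

theorem hasDerivAt_partial_fst {g : ℝ × ℝ → ℝ} {z : ℝ × ℝ} (hg : DifferentiableAt ℝ g z) :
    HasDerivAt (fun x => g (x, z.2)) (fderiv ℝ g z (1, 0)) z.1 := by
  have h1 : HasDerivAt (fun x : ℝ => (x, z.2)) ((1 : ℝ), (0 : ℝ)) z.1 :=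
    (hasDerivAt_id z.1).prodMk (hasDerivAt_const z.1 z.2)
  exact HasFDerivAt.comp_hasDerivAt (f := fun x : ℝ => (x, z.2)) z.1 hg.hasFDerivAt h1

theorem hasDerivAt_partial_snd {g : ℝ × ℝ → ℝ} {z : ℝ × ℝ} (hg : DifferentiableAt ℝ g z) :
    HasDerivAt (fun s => g (z.1, s)) (fderiv ℝ g z (0, 1)) z.2 := by
  have h1 : HasDerivAt (fun s : ℝ => (z.1, s)) ((0 : ℝ), (1 : ℝ)) z.2 :=
    (hasDerivAt_const z.2 z.1).prodMk (hasDerivAt_id z.2)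
  exact HasFDerivAt.comp_hasDerivAt (f := fun x : ℝ => (z.1, x)) z.2 hg.hasFDerivAt h1

/-- Differentiation under the integral sign: the partial derivative is bounded on the compact set
`closedBall x₀ 1 × uIcc a b`, so a constant dominates it. -/
theorem hasDerivAt_integral_fst {g : ℝ × ℝ → ℝ} (hg : ContDiff ℝ 1 g) (a b x₀ : ℝ) :
    HasDerivAt (fun x => ∫ σ in a..b, g (x, σ))
      (∫ σ in a..b, fderiv ℝ g (x₀, σ) (1, 0)) x₀ := by
  have hc : Continuous fun z : ℝ × ℝ => fderiv ℝ g z (1, 0) :=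
    (hg.continuous_fderiv (by norm_num)).clm_apply continuous_const
  have hcg := hg.continuous
  obtain ⟨C, hC⟩ := ((isCompact_closedBall x₀ 1).prod (isCompact_uIcc (a := a) (b := b))).exists_bound_of_continuousOn
    hc.continuousOn
  refine (intervalIntegral.hasDerivAt_integral_of_dominated_loc_of_deriv_le
    (F' := fun x σ => fderiv ℝ g (x, σ) (1, 0)) (bound := fun _ => C)
    (Metric.closedBall_mem_nhds x₀ one_pos) ?_ ?_ ?_ ?_ ?_ ?_).2
  · exact Eventually.of_forall fun x =>
      (Continuous.aestronglyMeasurable (by fun_prop))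
  · exact Continuous.intervalIntegrable (by fun_prop) _ _
  · exact Continuous.aestronglyMeasurable (hc.comp (by fun_prop))
  · exact Eventually.of_forall fun t ht x hx => hC (x, t) ⟨hx, uIoc_subset_uIcc ht⟩
  · simp
  · exact Eventually.of_forall fun t ht x hx =>
      hasDerivAt_partial_fst (z := (x, t)) (hg.differentiable (by norm_num) _)

/-- Induction on `n`: one partial derivative is `g` itself, the other is the primitive of `∂₁g`,
which has one derivative fewer. The initial-value derivative of a flow is the exponential of such a
primitive. -/
theorem contDiff_primitive_snd (s₀ : ℝ) (n : ℕ) : ∀ g : ℝ × ℝ → ℝ, ContDiff ℝ n g →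
    ContDiff ℝ n fun z : ℝ × ℝ => ∫ σ in s₀..z.2, g (z.1, σ) := by
  have hcont : ∀ g : ℝ × ℝ → ℝ, Continuous g →
      Continuous fun z : ℝ × ℝ => ∫ σ in s₀..z.2, g (z.1, σ) := by
    intro g hg
    exact intervalIntegral.continuous_parametric_intervalIntegral_of_continuous
      (f := fun (z : ℝ × ℝ) σ => g (z.1, σ)) (by unfold Function.uncurry; fun_prop) continuous_snd
  induction n with
  | zero =>
    intro g hg
    simp only [Nat.cast_zero, contDiff_zero] at hg ⊢
    exact hcont g hg
  | succ n ih =>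
    intro g hg
    have h1 : ContDiff ℝ 1 g := hg.of_le (by exact_mod_cast Nat.le_add_left 1 n)
    have hd : ContDiff ℝ n fun z : ℝ × ℝ => fderiv ℝ g z (1, 0) :=
      (hg.fderiv_right (m := n) (by norm_cast)).clm_apply contDiff_const
    push_cast
    refine contDiff_succ_of_partial_derivs
      (p := fun z => ∫ σ in s₀..z.2, fderiv ℝ g (z.1, σ) (1, 0)) (q := g) ?_ ?_ (ih _ hd)
      (hg.of_le (by exact_mod_cast Nat.le_succ n))
    · intro z
      exact hasDerivAt_integral_fst h1 _ _ _
    · intro z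
      have hgc := hg.continuous
      have hc : Continuous fun σ => g (z.1, σ) := by fun_prop
      exact intervalIntegral.integral_hasDerivAt_right (hc.intervalIntegrable _ _)
        (hc.stronglyMeasurableAtFilter _ _) hc.continuousAt

open scoped NNReal in
/-- A bounded continuous field that is uniformly Lipschitz in space has global solutions. -/
theorem exists_global_solution {f : ℝ × ℝ → ℝ} {L K : ℝ≥0} (hf : Continuous f)
    (hL : ∀ z, |f z| ≤ L) (hK : ∀ s, LipschitzWith K fun x => f (x, s)) (s₀ x : ℝ) :
    ∃ γ : ℝ → ℝ, γ s₀ = x ∧ ∀ s, HasDerivAt γ (f (γ s, s)) s := by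
  -- At speed at most `L`, a solution stays within `L * (N + 1)` of `x` during this time, so
  -- Picard-Lindelöf needs no smallness of the interval.
  have hloc : ∀ N : ℕ, ∃ γ : ℝ → ℝ, γ s₀ = x ∧
      ∀ s ∈ Ioo (s₀ - (N + 1)) (s₀ + (N + 1)), HasDerivAt γ (f (γ s, s)) s := by
    intro N
    have hN : (0 : ℝ) ≤ N := N.cast_nonneg
    have hPL : IsPicardLindelof (fun s x => f (x, s)) (tmin := s₀ - (N + 1)) (tmax := s₀ + (N + 1))
        ⟨s₀, by constructor <;> linarith⟩ x (L * (N + 1)) 0 L K :=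
      { lipschitzOnWith := fun t _ => (hK t).lipschitzOnWith
        continuousOn := fun y _ => by fun_prop
        norm_le := fun t _ y _ => hL _
        mul_max_le := by simp }
    obtain ⟨γ, h0, hγ⟩ := hPL.exists_eq_forall_mem_Icc_hasDerivWithinAt₀
    exact ⟨γ, h0, fun s hs => (hγ s (Ioo_subset_Icc_self hs)).hasDerivAt (Icc_mem_nhds hs.1 hs.2)⟩
  choose γ h0 hγ using hloc
  have huniq : ∀ M N : ℕ, M ≤ N → EqOn (γ M) (γ N) (Ioo (s₀ - (M + 1)) (s₀ + (M + 1))) := by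
    intro M N hMN
    have hMN' : (M : ℝ) ≤ N := by exact_mod_cast hMN
    have hM : (0 : ℝ) ≤ M := M.cast_nonneg
    refine ODE_solution_unique_of_mem_Ioo (v := fun s x => f (x, s)) (K := K)
      (s := fun _ => univ) (t₀ := s₀) (fun t _ => (hK t).lipschitzOnWith)
      ⟨by linarith, by linarith⟩ (fun t ht => ⟨hγ M t ht, mem_univ _⟩)
      (fun t ht => ⟨hγ N t ⟨?_, ?_⟩, mem_univ _⟩) ((h0 M).trans (h0 N).symm)
    · linarith [ht.1]
    · linarith [ht.2]
  have hmem : ∀ s : ℝ, ∀ N : ℕ, |s - s₀| < N + 1 → s ∈ Ioo (s₀ - (N + 1)) (s₀ + (N + 1)) := by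
    intro s N h
    have := abs_lt.1 h
    constructor <;> linarith [this.1, this.2]
  -- The index jumps with `s`, but near a given `s` it is at most `⌈|s - s₀|⌉₊ + 1`; by uniqueness
  -- the patched function agrees there with that single solution.
  refine ⟨fun s => γ ⌈|s - s₀|⌉₊ s, h0 _, fun s => ?_⟩
  have hs : |s - s₀| < (⌈|s - s₀|⌉₊ : ℝ) + 1 := (Nat.le_ceil _).trans_lt (lt_add_one _)
  have heq : (fun s => γ ⌈|s - s₀|⌉₊ s) =ᶠ[𝓝 s] γ (⌈|s - s₀|⌉₊ + 1) := by
    have : ∀ᶠ t in 𝓝 s, |t - s₀| < (⌈|s - s₀|⌉₊ : ℝ) + 1 :=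
      (ContinuousAt.eventually_lt (by fun_prop) continuousAt_const hs)
    filter_upwards [this] with t ht
    refine huniq _ _ ?_ (hmem t _ ((Nat.le_ceil _).trans_lt (lt_add_one _)))
    exact Nat.ceil_le.2 (by push_cast; exact ht.le)
  have hd := hγ (⌈|s - s₀|⌉₊ + 1) s (hmem s _ (by push_cast; linarith))
  have := hd.congr_of_eventuallyEq heq
  rwa [← heq.eq_of_nhds] at this

/-- The flow of a compactly supported smooth time-dependent field on the line is smooth, and
strictly increasing in the initial value. -/
theorem exists_contDiff_flow {f : ℝ × ℝ → ℝ} (hf : ContDiff ℝ ∞ f) (hcs : HasCompactSupport f)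
    (s₀ : ℝ) : ∃ Φ : ℝ × ℝ → ℝ, ContDiff ℝ ∞ Φ ∧ (∀ x, Φ (x, s₀) = x) ∧
      ∀ z, fderiv ℝ Φ z (0, 1) = f (Φ z, z.2) ∧ 0 < fderiv ℝ Φ z (1, 0) := by
  have hfc := hf.continuous
  have hf1 : ContDiff ℝ 1 f := hf.of_le (by norm_cast)
  set D : ℝ × ℝ → ℝ := fun z => fderiv ℝ f z (1, 0) with hD
  have hDs : ContDiff ℝ ∞ D := (hf.fderiv_right (m := ∞) (by norm_cast)).clm_apply contDiff_const
  have hDc : Continuous D := hDs.continuous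
  obtain ⟨L, hL⟩ := hfc.bounded_above_of_compact_support hcs
  obtain ⟨K, hK⟩ := hDc.bounded_above_of_compact_support (hcs.fderiv_apply (𝕜 := ℝ) (1, 0))
  simp only [Real.norm_eq_abs] at hL hK
  have hL0 : 0 ≤ L := (abs_nonneg _).trans (hL 0)
  have hK0 : 0 ≤ K := (abs_nonneg _).trans (hK 0)
  have hpart : ∀ x s, HasDerivAt (fun x => f (x, s)) (D (x, s)) x := fun x s =>
    hasDerivAt_partial_fst (z := (x, s)) (hf1.differentiable (by norm_num) _)
  have hLip : ∀ s, LipschitzWith ⟨K, hK0⟩ fun x => f (x, s) := fun s =>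
    lipschitzWith_of_nnnorm_deriv_le (fun x => (hpart x s).differentiableAt) fun x => by
      rw [(hpart x s).deriv]; exact hK _
  choose γ h0 hγ using exists_global_solution (L := ⟨L, hL0⟩) hfc hL hLip s₀
  have hγc : ∀ x, Continuous (γ x) := fun x =>
    continuous_iff_continuousAt.2 fun s => (hγ x s).continuousAt
  -- the divided difference of `f` in its first argument
  set Q : ℝ → ℝ → ℝ → ℝ := fun a b s => ∫ u in (0 : ℝ)..1, D (a + u * (b - a), s) with hQ
  have hQc : Continuous fun w : ℝ × ℝ × ℝ => Q w.1 w.2.1 w.2.2 :=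
    intervalIntegral.continuous_parametric_intervalIntegral_of_continuous'
      (f := fun (w : ℝ × ℝ × ℝ) u => D (w.1 + u * (w.2.1 - w.1), w.2.2))
      (by unfold Function.uncurry; fun_prop) 0 1
  have hQK : ∀ a b s, |Q a b s| ≤ K := by
    intro a b s
    have := intervalIntegral.norm_integral_le_of_norm_le_const (a := (0 : ℝ)) (b := 1)
      (f := fun u => D (a + u * (b - a), s)) (C := K) (fun u _ => hK _)
    simpa using this
  have hQd : ∀ a b s, f (b, s) - f (a, s) = Q a b s * (b - a) := by
    intro a b s
    have h1 : ∀ u ∈ uIcc (0 : ℝ) 1, HasDerivAt (fun u => f (a + u * (b - a), s))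
        (D (a + u * (b - a), s) * (b - a)) u := by
      intro u _
      have : HasDerivAt (fun u => a + u * (b - a)) (b - a) u := by
        simpa using ((hasDerivAt_id u).mul_const (b - a)).const_add a
      exact (hpart _ s).comp u this
    have h2 := intervalIntegral.integral_eq_sub_of_hasDerivAt h1
      (Continuous.intervalIntegrable (by fun_prop) _ _)
    rw [intervalIntegral.integral_mul_const] at h2
    simp only [one_mul, zero_mul, add_zero, add_sub_cancel] at h2
    exact h2.symm
  have hqc : ∀ x y, Continuous fun σ => Q (γ x σ) (γ y σ) σ := fun x y =>
    hQc.comp ((hγc x).prodMk ((hγc y).prodMk continuous_id))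
  -- The difference of two solutions solves the linear equation `u' = Q u`. The resulting formula
  -- yields both the continuity of the flow in the initial value and its derivative.
  have hdiff : ∀ x y s, γ y s - γ x s =
      (y - x) * exp (∫ σ in s₀..s, Q (γ x σ) (γ y σ) σ) := by
    intro x y s
    have hE : ∀ s, HasDerivAt
        (fun s => (γ y s - γ x s) * exp (-∫ σ in s₀..s, Q (γ x σ) (γ y σ) σ)) 0 s := by
      intro s
      have h1 : HasDerivAt (fun s => ∫ σ in s₀..s, Q (γ x σ) (γ y σ) σ) (Q (γ x s) (γ y s) s) s :=
        intervalIntegral.integral_hasDerivAt_right ((hqc x y).intervalIntegrable _ _)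
          ((hqc x y).stronglyMeasurableAtFilter _ _) (hqc x y).continuousAt
      have h2 := (((hγ y s).sub (hγ x s)).mul h1.neg.exp)
      refine h2.congr_deriv ?_
      simp only [hQd, Pi.sub_apply]
      ring
    have h3 := is_const_of_deriv_eq_zero (fun s => (hE s).differentiableAt)
      (fun s => (hE s).deriv) s s₀
    simp only [h0, intervalIntegral.integral_same, neg_zero, exp_zero, mul_one] at h3
    rw [← h3, mul_assoc, ← exp_add]
    simp
  set Φ : ℝ × ℝ → ℝ := fun z => γ z.1 z.2 with hΦ
  have hbd : ∀ x y s, |γ y s - γ x s| ≤ |y - x| * exp (K * |s - s₀|) := by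
    intro x y s
    rw [hdiff, abs_mul, abs_exp]
    gcongr
    have := intervalIntegral.norm_integral_le_of_norm_le_const (a := s₀) (b := s)
      (f := fun σ => Q (γ x σ) (γ y σ) σ) (C := K) (fun u _ => hQK _ _ _)
    exact (le_abs_self _).trans this
  have hΦc : Continuous Φ := by
    rw [continuous_iff_continuousAt]
    rintro ⟨x, s⟩
    have h1 : Tendsto (fun z : ℝ × ℝ => γ z.1 z.2 - γ x z.2) (𝓝 (x, s)) (𝓝 0) := by
      refine squeeze_zero_norm (fun z => hbd x z.1 z.2) ?_
      have : Continuous fun z : ℝ × ℝ => |z.1 - x| * exp (K * |z.2 - s₀|) := by fun_prop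
      simpa using this.tendsto (x, s)
    have h2 : Tendsto (fun z : ℝ × ℝ => γ x z.2) (𝓝 (x, s)) (𝓝 (γ x s)) :=
      ((hγc x).comp continuous_snd).tendsto (x, s)
    simpa [ContinuousAt, hΦ] using h1.add h2
  have hdx : ∀ z : ℝ × ℝ, HasDerivAt (fun x => Φ (x, z.2))
      (exp (∫ σ in s₀..z.2, D (Φ (z.1, σ), σ))) z.1 := by
    rintro ⟨x, s⟩
    rw [hasDerivAt_iff_tendsto_slope]
    have hc : Continuous fun y => exp (∫ σ in s₀..s, Q (γ x σ) (γ y σ) σ) := by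
      refine continuous_exp.comp
        (intervalIntegral.continuous_parametric_intervalIntegral_of_continuous'
          (f := fun y σ => Q (γ x σ) (γ y σ) σ) ?_ s₀ s)
      exact hQc.comp (((hγc x).comp continuous_snd).prodMk (hΦc.prodMk continuous_snd))
    have hQxx : ∀ a s, Q a a s = D (a, s) := by intro a s; simp [hQ]
    have ht := (hc.tendsto x).mono_left (nhdsWithin_le_nhds (s := {x}ᶜ))
    simp only [hQxx] at ht
    refine ht.congr' ?_
    filter_upwards [self_mem_nhdsWithin] with y hy
    have hyx : y - x ≠ 0 := sub_ne_zero.2 hy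
    rw [slope_def_field]
    simp only [hΦ, hdiff]
    field_simp
  have hds : ∀ z : ℝ × ℝ, HasDerivAt (fun s => Φ (z.1, s)) (f (Φ z, z.2)) z.2 :=
    fun z => hγ z.1 z.2
  -- Bootstrap: both partial derivatives are expressed through `Φ`, so they are of class `C^n`
  -- whenever `Φ` is.
  have hsm : ∀ n : ℕ, ContDiff ℝ n Φ := by
    intro n
    induction n with
    | zero => simpa using hΦc
    | succ n ih =>
      push_cast
      have hn : ((n : ℕ∞) : WithTop ℕ∞) ≤ ∞ := by norm_cast; exact le_top
      refine contDiff_succ_of_partial_derivs hdx hds ?_ ?_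
      · refine ContDiff.exp (contDiff_primitive_snd s₀ n (fun w => D (Φ w, w.2)) ?_)
        exact (hDs.of_le hn).comp (ih.prodMk contDiff_snd)
      · exact (hf.of_le hn).comp (ih.prodMk contDiff_snd)
  have hΦs : ContDiff ℝ ∞ Φ := contDiff_infty.2 hsm
  have hΦd : Differentiable ℝ Φ := hΦs.differentiable (by simp)
  refine ⟨Φ, hΦs, h0, fun z => ⟨?_, ?_⟩⟩
  · exact (hasDerivAt_partial_snd (hΦd z)).unique (hds z)
  · rw [(hasDerivAt_partial_fst (hΦd z)).unique (hdx z)]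
    exact exp_pos _

/-- Local version: a smooth field `f` on an open set agrees near a point `q` with one
that has a smooth global flow. -/
theorem exists_local_flow {f : ℝ × ℝ → ℝ} {O : Set (ℝ × ℝ)} (hO : IsOpen O)
    (hf : ContDiffOn ℝ ∞ f O) {q : ℝ × ℝ} (hq : q ∈ O) :
    ∃ (O' : Set (ℝ × ℝ)) (Φ : ℝ × ℝ → ℝ), IsOpen O' ∧ q ∈ O' ∧ O' ⊆ O ∧ ContDiff ℝ ∞ Φ ∧
      Φ q = q.1 ∧ ∀ z, 0 < fderiv ℝ Φ z (1, 0) ∧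
        ((Φ z, z.2) ∈ O' → fderiv ℝ Φ z (0, 1) = f (Φ z, z.2)) := by
  obtain ⟨R, hR, hRO⟩ := Metric.isOpen_iff.1 hO q hq
  -- The cutoff makes `χ f` globally smooth with compact support and leaves `f` unchanged on the
  -- ball of radius `R / 3`, which becomes `O'`.
  let χ : ContDiffBump q := ⟨R / 3, R / 2, by positivity, by linarith⟩
  have hsub : Metric.closedBall q (R / 2) ⊆ O :=
    (Metric.closedBall_subset_ball (by linarith)).trans hRO
  have hF : ContDiff ℝ ∞ fun z => χ z * f z := by
    rw [contDiff_iff_contDiffAt]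
    intro z
    by_cases hz : z ∈ O
    · exact χ.contDiff.contDiffAt.mul (hf.contDiffAt (hO.mem_nhds hz))
    · have : (fun z => χ z * f z) =ᶠ[𝓝 z] fun _ => 0 := by
        have hz' : z ∈ (Metric.closedBall q (R / 2))ᶜ := fun h => hz (hsub h)
        filter_upwards [Metric.isClosed_closedBall.isOpen_compl.mem_nhds hz'] with y hy
        rw [χ.zero_of_le_dist, zero_mul]
        simp only [mem_compl_iff, Metric.mem_closedBall, not_le] at hy
        exact hy.le
      exact contDiffAt_const.congr_of_eventuallyEq this
  have hcs : HasCompactSupport fun z => χ z * f z := χ.hasCompactSupport.mul_right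
  obtain ⟨Φ, hΦ, h0, hd⟩ := exists_contDiff_flow hF hcs q.2
  refine ⟨Metric.ball q (R / 3), Φ, Metric.isOpen_ball, Metric.mem_ball_self (by positivity),
    (Metric.ball_subset_ball (by linarith)).trans hRO, hΦ, h0 q.1, fun z => ⟨(hd z).2, fun hz => ?_⟩⟩
  rw [(hd z).1, χ.one_of_mem_closedBall (Metric.ball_subset_closedBall hz), one_mul]

/-! ### Splitting of a rotation-invariant metric -/

theorem inner_E3 (v w : E3) : ⟪v, w⟫ = v 0 * w 0 + v 1 * w 1 + v 2 * w 2 := by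
  simp [PiLp.inner_apply, Fin.sum_univ_three, mul_comm]

/-- The rotation whose columns are the unit vectors of the polar coordinates at the point
with polar angle `θ` and azimuth `φ`. -/
noncomputable def polarFrame (θ φ : ℝ) : Matrix (Fin 3) (Fin 3) ℝ :=
  !![cos θ * cos φ, -sin φ, sin θ * cos φ;
     cos θ * sin φ, cos φ, sin θ * sin φ;
     -sin θ, 0, cos θ]

theorem polarFrame_mem (θ φ : ℝ) :
    polarFrame θ φ ∈ Matrix.specialOrthogonalGroup (Fin 3) ℝ := by
  have hθ := sin_sq_add_cos_sq θ
  have hφ := sin_sq_add_cos_sq φ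
  rw [Matrix.mem_specialOrthogonalGroup_iff, Matrix.mem_orthogonalGroup_iff']
  constructor
  · ext i j
    fin_cases i <;> fin_cases j <;>
      simp [polarFrame, Matrix.mul_apply, Fin.sum_univ_three] <;> grind
  · simp only [polarFrame, Matrix.det_fin_three]
    simp
    grind

theorem polarFrame_apply (θ φ : ℝ) (v : E3) :
    Matrix.toEuclideanLin (polarFrame θ φ) v =
      !₂[cos θ * cos φ * v 0 - sin φ * v 1 + sin θ * cos φ * v 2,
        cos θ * sin φ * v 0 + cos φ * v 1 + sin θ * sin φ * v 2,
        -sin θ * v 0 + cos θ * v 2] := by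
  ext i
  fin_cases i <;>
    simp [polarFrame, Matrix.toLpLin_apply, dotProduct, Fin.sum_univ_three]; ring

theorem spherePoint_mem (θ φ : ℝ) : spherePoint θ φ ∈ unitSphere := by
  have hθ := sin_sq_add_cos_sq θ
  have hφ := sin_sq_add_cos_sq φ
  have : ⟪spherePoint θ φ, spherePoint θ φ⟫ = 1 := by
    rw [inner_E3]; simp [spherePoint]; grind
  rw [unitSphere, mem_sphere_zero_iff_norm]
  rw [real_inner_self_eq_norm_sq] at this
  nlinarith [norm_nonneg (spherePoint θ φ)]

theorem exists_spherePoint {n : E3} (hn : n ∈ unitSphere) : ∃ θ φ, spherePoint θ φ = n := by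
  rw [unitSphere, mem_sphere_zero_iff_norm] at hn
  have h1 : n 0 * n 0 + n 1 * n 1 + n 2 * n 2 = 1 := by
    rw [← inner_E3, real_inner_self_eq_norm_sq, hn]; norm_num
  set z : ℂ := ⟨n 0, n 1⟩ with hz
  have hs : sin (arccos (n 2)) = ‖z‖ := by
    rw [sin_arccos, Complex.norm_def]
    congr 1
    simp [Complex.normSq_apply, hz]
    linarith
  refine ⟨arccos (n 2), z.arg, ?_⟩
  ext i
  fin_cases i
  · simp [spherePoint, hs, Complex.norm_mul_cos_arg, hz]
  · simp [spherePoint, hs, Complex.norm_mul_sin_arg, hz]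
  · simp only [spherePoint, Fin.reduceFinMk]
    simp
    exact cos_arccos (by nlinarith [mul_self_nonneg (n 0), mul_self_nonneg (n 1)])
      (by nlinarith [mul_self_nonneg (n 0), mul_self_nonneg (n 1)])

namespace SphericalSpacetime

variable (S : SphericalSpacetime)

/-- The metric of the orbit space. -/
noncomputable def orbitMetric (x : ℝ × ℝ) : LinearMap.BilinForm ℝ (ℝ × ℝ) :=
  (S.g (x, spherePoint 0 0)).compl₁₂ (LinearMap.inl ℝ (ℝ × ℝ) E3) (LinearMap.inl ℝ (ℝ × ℝ) E3)

/-- The squared radius of curvature of the orbits. -/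
noncomputable def orbitRadiusSq (x : ℝ × ℝ) : ℝ :=
  S.g (x, spherePoint 0 0) (0, !₂[1, 0, 0]) (0, !₂[1, 0, 0])

theorem orbitMetric_apply (x a b : ℝ × ℝ) :
    S.orbitMetric x a b = S.g (x, spherePoint 0 0) (a, 0) (b, 0) := rfl

variable {S} {x : ℝ × ℝ}

theorem orbitMetric_symm (hx : x ∈ S.U) (a b : ℝ × ℝ) :
    S.orbitMetric x a b = S.orbitMetric x b a :=
  S.symm_g x hx _ (spherePoint_mem 0 0) _ _ (by simp) (by simp)

/-- The rotations `polarFrame 0 ψ` fix the pole. The half turn reverses tangent vectors of the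
sphere and so kills the mixed terms; the quarter turn makes the spherical part a multiple of the
Euclidean product. -/
theorem g_northPole (hx : x ∈ S.U) (a b : ℝ × ℝ) (α β α' β' : ℝ) :
    S.g (x, spherePoint 0 0) (a, !₂[α, β, 0]) (b, !₂[α', β', 0]) =
      S.orbitMetric x a b + S.orbitRadiusSq x * (α * α' + β * β') := by
  set G := S.g (x, spherePoint 0 0) with hG
  have htan : ∀ α β : ℝ, ⟪spherePoint 0 0, (!₂[α, β, 0] : E3)⟫ = 0 := by
    intro α β; simp [inner_E3, spherePoint]
  have hrot : ∀ (ψ : ℝ) (a b : ℝ × ℝ) (α β α' β' : ℝ),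
      G (a, !₂[cos ψ * α - sin ψ * β, sin ψ * α + cos ψ * β, 0])
        (b, !₂[cos ψ * α' - sin ψ * β', sin ψ * α' + cos ψ * β', 0]) =
      G (a, !₂[α, β, 0]) (b, !₂[α', β', 0]) := by
    intro ψ a b α β α' β'
    have := S.rotation_g _ (polarFrame_mem 0 ψ) x hx _ (spherePoint_mem 0 0)
      (a, !₂[α, β, 0]) (b, !₂[α', β', 0]) (htan α β) (htan α' β')
    have h0 : Matrix.toEuclideanLin (polarFrame 0 ψ) (spherePoint 0 0) = spherePoint 0 0 := by
      rw [polarFrame_apply]; simp [spherePoint]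
    rw [h0, ← hG] at this
    simp only [polarFrame_apply] at this
    simpa using this
  have hz : (!₂[(0 : ℝ), 0, 0] : E3) = 0 := by ext i; fin_cases i <;> simp
  have hsplit : ∀ α β : ℝ, (!₂[α, β, 0] : E3) = α • !₂[1, 0, 0] + β • !₂[0, 1, 0] := by
    intro α β; ext i; fin_cases i <;> simp
  have hneg : ∀ α β : ℝ, (!₂[-α, -β, 0] : E3) = -!₂[α, β, 0] := by
    intro α β; ext i; fin_cases i <;> simp
  have hneg' : ∀ v : E3, ((0 : ℝ × ℝ), -v) = -((0 : ℝ × ℝ), v) := by intro v; simp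
  have hc1 : ∀ (a : ℝ × ℝ) (α β : ℝ), G (a, 0) (0, !₂[α, β, 0]) = 0 := by
    intro a α β
    have := hrot π a 0 0 0 α β
    simp only [cos_pi, sin_pi, mul_zero, zero_mul, sub_zero, add_zero, zero_add, neg_mul, one_mul,
      hz, hneg, hneg', map_neg] at this
    linarith
  have hc2 : ∀ (a : ℝ × ℝ) (α β : ℝ), G (0, !₂[α, β, 0]) (a, 0) = 0 := by
    intro a α β
    refine Eq.trans ?_ (hc1 a α β)
    exact S.symm_g x hx _ (spherePoint_mem 0 0) (0, _) (a, 0) (htan α β) (inner_zero_right _)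
  have h11 : G (0, !₂[0, 1, 0]) (0, !₂[0, 1, 0]) = S.orbitRadiusSq x := by
    have := hrot (π / 2) 0 0 1 0 1 0
    simpa [orbitRadiusSq] using this
  have h12 : G (0, !₂[1, 0, 0]) (0, !₂[0, 1, 0]) = 0 := by
    have h1 := hrot (π / 2) 0 0 1 0 0 1
    have h2 : G (0, !₂[0, 1, 0]) (0, !₂[1, 0, 0]) = G (0, !₂[1, 0, 0]) (0, !₂[0, 1, 0]) :=
      S.symm_g x hx _ (spherePoint_mem 0 0) (0, _) (0, _) (htan 0 1) (htan 1 0)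
    have h3 : (!₂[(-1 : ℝ), 0, 0] : E3) = -!₂[1, 0, 0] := by simpa using hneg 1 0
    simp [h3, hneg', -Prod.neg_mk] at h1
    linarith
  have h21 : G (0, !₂[0, 1, 0]) (0, !₂[1, 0, 0]) = 0 := by
    refine Eq.trans ?_ h12
    exact S.symm_g x hx _ (spherePoint_mem 0 0) (0, _) (0, _) (htan 0 1) (htan 1 0)
  have h00 : G (0, !₂[1, 0, 0]) (0, !₂[1, 0, 0]) = S.orbitRadiusSq x := rfl
  have hadd : ∀ (a : ℝ × ℝ) (v : E3), (a, v) = (a, (0 : E3)) + (0, v) := by intro a v; simp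
  have hsm : ∀ α β : ℝ, ((0 : ℝ × ℝ), (!₂[α, β, 0] : E3)) =
      α • (0, !₂[1, 0, 0]) + β • (0, !₂[0, 1, 0]) := by
    intro α β; rw [hsplit]; simp
  rw [hadd a, hadd b, map_add, map_add, LinearMap.add_apply, LinearMap.add_apply, hc1, hc2, hsm α β,
    hsm α' β']
  simp only [map_add, map_smul, LinearMap.add_apply, LinearMap.smul_apply, h11, h12, h21, h00,
    smul_eq_mul]
  rw [orbitMetric_apply]
  ring

/-- A rotation-invariant metric is the sum of a metric on the orbit space and a multiple of the
round metric. -/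
theorem g_eq (hx : x ∈ S.U) {n : E3} (hn : n ∈ unitSphere) {u v : (ℝ × ℝ) × E3}
    (hu : ⟪n, u.2⟫ = 0) (hv : ⟪n, v.2⟫ = 0) :
    S.g (x, n) u v = S.orbitMetric x u.1 v.1 + S.orbitRadiusSq x * ⟪u.2, v.2⟫ := by
  obtain ⟨θ, φ, rfl⟩ := exists_spherePoint hn
  have hθ := sin_sq_add_cos_sq θ
  have hφ := sin_sq_add_cos_sq φ
  -- The third column of `polarFrame θ φ` is the normal, so a tangent vector is a combination of the
  -- first two, with its inner products as coefficients.
  have hlift : ∀ w : E3, ⟪spherePoint θ φ, w⟫ = 0 → ∃ α β : ℝ,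
      w = Matrix.toEuclideanLin (polarFrame θ φ) !₂[α, β, 0] := by
    intro w hw
    refine ⟨cos θ * cos φ * w 0 + cos θ * sin φ * w 1 - sin θ * w 2, -sin φ * w 0 + cos φ * w 1, ?_⟩
    simp only [inner_E3, spherePoint] at hw
    simp at hw
    rw [polarFrame_apply]
    ext i
    fin_cases i
    · simp
      linear_combination -(cos φ ^ 2 * w 0 + cos φ * sin φ * w 1) * hθ - w 0 * hφ +
        sin θ * cos φ * hw
    · simp
      linear_combination -(cos φ * sin φ * w 0 + sin φ ^ 2 * w 1) * hθ - w 1 * hφ +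
        sin θ * sin φ * hw
    · simp
      linear_combination -w 2 * hθ + cos θ * hw
  obtain ⟨a, u⟩ := u
  obtain ⟨b, v⟩ := v
  obtain ⟨α, β, hu'⟩ := hlift u hu
  obtain ⟨α', β', hv'⟩ := hlift v hv
  have hn0 : spherePoint θ φ = Matrix.toEuclideanLin (polarFrame θ φ) (spherePoint 0 0) := by
    rw [polarFrame_apply]; simp [spherePoint]
  have := S.rotation_g _ (polarFrame_mem θ φ) x hx _ (spherePoint_mem 0 0)
      (a, !₂[α, β, 0]) (b, !₂[α', β', 0]) (by simp [inner_E3, spherePoint])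
      (by simp [inner_E3, spherePoint])
  simp only [← hn0, ← hu', ← hv'] at this
  rw [this, g_northPole hx]
  congr 2
  rw [hu', hv', polarFrame_apply, polarFrame_apply, inner_E3]
  simp
  grind

/-- A nonzero vector `w` tangent to the sphere and orthogonal to the spherical part of the timelike
vector `u` gives `(0, w) ⟂ u`, hence a spacelike vector. -/
theorem orbitRadiusSq_pos (hx : x ∈ S.U) : 0 < S.orbitRadiusSq x := by
  obtain ⟨u, hu, -, h⟩ := S.lorentzian_g x hx _ (spherePoint_mem 0 0)
  obtain ⟨w, hw, hw0, huw⟩ : ∃ w : E3, ⟪spherePoint 0 0, w⟫ = 0 ∧ w ≠ 0 ∧ ⟪u.2, w⟫ = 0 := by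
    by_cases h0 : u.2 0 = 0 ∧ u.2 1 = 0
    · refine ⟨!₂[1, 0, 0], by simp [inner_E3, spherePoint], fun h => ?_, by simp [inner_E3, h0.1]⟩
      simpa using congrArg (fun v : E3 => v 0) h
    · refine ⟨!₂[-u.2 1, u.2 0, 0], by simp [inner_E3, spherePoint], fun h => h0 ⟨?_, ?_⟩,
        by simp [inner_E3]; ring⟩
      · simpa using congrArg (fun v : E3 => v 1) h
      · simpa using congrArg (fun v : E3 => v 0) h
  have h1 := h (0, w) hw (by simpa using hw0) (by
    rw [g_eq hx (spherePoint_mem 0 0) hu hw]; simp [huw])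
  rw [g_eq hx (spherePoint_mem 0 0) hw hw] at h1
  simp only [map_zero, zero_add] at h1
  exact pos_of_mul_pos_left h1 real_inner_self_nonneg

/-- The determinant of the metric of the orbit space. -/
noncomputable def orbitDet (S : SphericalSpacetime) (x : ℝ × ℝ) : ℝ :=
  S.orbitMetric x (1, 0) (1, 0) * S.orbitMetric x (0, 1) (0, 1) - S.orbitMetric x (1, 0) (0, 1) ^ 2

theorem orbitMetric_expand (hx : x ∈ S.U) (a b : ℝ × ℝ) :
    S.orbitMetric x a b = a.1 * b.1 * S.orbitMetric x (1, 0) (1, 0)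
      + (a.1 * b.2 + a.2 * b.1) * S.orbitMetric x (1, 0) (0, 1)
      + a.2 * b.2 * S.orbitMetric x (0, 1) (0, 1) := by
  have h : ∀ a : ℝ × ℝ, a = a.1 • (1, 0) + a.2 • (0, 1) := by intro a; ext <;> simp
  conv_lhs => rw [h a, h b]
  simp only [map_add, map_smul, LinearMap.add_apply, LinearMap.smul_apply, smul_eq_mul]
  rw [orbitMetric_symm hx (0, 1) (1, 0)]
  ring

/-- The sphere contributes nonnegatively, so the orbit part `a` of a timelike vector is timelike,
and a nonzero `b ⟂ a` is spacelike. The Gram determinant of `a, b` is negative, and it is `orbitDet`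
times a square. -/
theorem orbitDet_neg (hx : x ∈ S.U) : S.orbitDet x < 0 := by
  obtain ⟨u, hu, hu0, h⟩ := S.lorentzian_g x hx _ (spherePoint_mem 0 0)
  rw [g_eq hx (spherePoint_mem 0 0) hu hu] at hu0
  have hc := orbitRadiusSq_pos hx
  set a := u.1 with ha
  have haa : S.orbitMetric x a a < 0 := by
    have : 0 ≤ S.orbitRadiusSq x * ⟪u.2, u.2⟫ := mul_nonneg hc.le real_inner_self_nonneg
    linarith
  -- a vector orthogonal to `a`
  set b : ℝ × ℝ := (-S.orbitMetric x a (0, 1), S.orbitMetric x a (1, 0)) with hb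
  have hab : S.orbitMetric x a b = 0 := by
    have : b = b.1 • (1, 0) + b.2 • (0, 1) := by ext <;> simp
    rw [this, map_add, map_smul, map_smul]
    simp [hb]
    ring
  have hb0 : b ≠ 0 := by
    intro h0
    have h1 : S.orbitMetric x a (0, 1) = 0 := by simpa [hb] using congrArg Prod.fst h0
    have h2 : S.orbitMetric x a (1, 0) = 0 := by simpa [hb] using congrArg Prod.snd h0
    have : a = a.1 • (1, 0) + a.2 • (0, 1) := by ext <;> simp
    have h3 : S.orbitMetric x a a = a.1 * S.orbitMetric x a (1, 0)
        + a.2 * S.orbitMetric x a (0, 1) := by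
      conv_lhs => arg 2; rw [this]
      rw [map_add, map_smul, map_smul, smul_eq_mul, smul_eq_mul]
    rw [h1, h2] at h3
    simp at h3
    linarith
  have hbb := h (b, 0) (by simp) (by simpa using hb0) (by
    rw [g_eq hx (spherePoint_mem 0 0) hu (by simp)]; simp [← ha, hab])
  rw [g_eq hx (spherePoint_mem 0 0) (by simp) (by simp)] at hbb
  simp only [inner_zero_left, mul_zero, add_zero] at hbb
  have key : S.orbitDet x * (a.1 * b.2 - a.2 * b.1) ^ 2 =
      S.orbitMetric x a a * S.orbitMetric x b b - S.orbitMetric x a b ^ 2 := by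
    rw [orbitMetric_expand hx a a, orbitMetric_expand hx b b, orbitMetric_expand hx a b, orbitDet]
    ring
  rw [hab] at key
  have : S.orbitMetric x a a * S.orbitMetric x b b < 0 := mul_neg_of_neg_of_pos haa hbb
  by_contra hd
  push Not at hd
  have := mul_nonneg hd (sq_nonneg (a.1 * b.2 - a.2 * b.1))
  linarith

theorem isOrbitRadius_iff {r : ℝ × ℝ → ℝ} :
    S.IsOrbitRadius r ↔ ∀ x ∈ S.U, 0 < r x ∧ r x ^ 2 = S.orbitRadiusSq x := by
  refine forall₂_congr fun x hx => and_congr_right fun _ => ⟨fun h => ?_, fun h n hn v w hv hw => ?_⟩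
  · have := h (spherePoint 0 0) (spherePoint_mem 0 0) !₂[1, 0, 0] !₂[1, 0, 0]
      (by simp [inner_E3, spherePoint]) (by simp [inner_E3, spherePoint])
    rw [inner_E3] at this
    simpa [orbitRadiusSq] using this.symm
  · rw [g_eq hx hn hv hw, h]
    simp

theorem exists_isOrbitRadius (S : SphericalSpacetime) : ∃ r : ℝ × ℝ → ℝ, S.IsOrbitRadius r :=
  ⟨fun x => √(S.orbitRadiusSq x), isOrbitRadius_iff.2 fun _ hx =>
    ⟨sqrt_pos.2 (orbitRadiusSq_pos hx), sq_sqrt (orbitRadiusSq_pos hx).le⟩⟩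

theorem contDiffOn_g_northPole (S : SphericalSpacetime) (u v : (ℝ × ℝ) × E3) :
    ContDiffOn ℝ ∞ (fun x => S.g (x, spherePoint 0 0) u v) S.U :=
  (S.smooth_g u v).comp (f := fun x : ℝ × ℝ => (x, spherePoint 0 0)) (by fun_prop)
    fun _ hx => ⟨hx, spherePoint_mem 0 0⟩

theorem IsOrbitRadius.contDiffOn {r : ℝ × ℝ → ℝ} (hr : S.IsOrbitRadius r) :
    ContDiffOn ℝ ∞ r S.U := by
  have h1 : ContDiffOn ℝ ∞ (fun x => √(S.orbitRadiusSq x)) S.U :=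
    (S.contDiffOn_g_northPole _ _).sqrt fun x hx => (orbitRadiusSq_pos hx).ne'
  refine h1.congr fun x hx => ?_
  obtain ⟨h2, h3⟩ := isOrbitRadius_iff.1 hr x hx
  rw [← h3, sqrt_sq h2.le]

theorem contDiffOn_orbitMetric (S : SphericalSpacetime) (a b : ℝ × ℝ) :
    ContDiffOn ℝ ∞ (fun x => S.orbitMetric x a b) S.U :=
  S.contDiffOn_g_northPole _ _

end SphericalSpacetime

/-! ### Metric components, `δ` and `(dr)²` in coordinates -/

theorem fderiv_spherePoint_comp (y v : Fin 4 → ℝ) :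
    DifferentiableAt ℝ (fun y : Fin 4 → ℝ => spherePoint (y 2) (y 3)) y ∧
    fderiv ℝ (fun y : Fin 4 → ℝ => spherePoint (y 2) (y 3)) y v =
      !₂[cos (y 2) * cos (y 3) * v 2 - sin (y 2) * sin (y 3) * v 3,
        cos (y 2) * sin (y 3) * v 2 + sin (y 2) * cos (y 3) * v 3, -sin (y 2) * v 2] := by
  have hd : DifferentiableAt ℝ (fun y : Fin 4 → ℝ => spherePoint (y 2) (y 3)) y := by
    rw [differentiableAt_euclidean]
    intro i
    fin_cases i <;> simp [spherePoint] <;> fun_prop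
  refine ⟨hd, ?_⟩
  -- The differential is computed along the line through `y` in direction `v`, one Euclidean
  -- component at a time.
  have hline : HasDerivAt (fun t : ℝ => y + t • v) v 0 := by
    simpa using ((hasDerivAt_id (0 : ℝ)).smul_const v).const_add y
  have hcoord : ∀ i, HasDerivAt (fun t : ℝ => (y + t • v) i) (v i) 0 :=
    fun i => (hasDerivAt_pi.1 hline) i
  have h1 : HasDerivAt (fun t : ℝ => spherePoint ((y + t • v) 2) ((y + t • v) 3))
      (fderiv ℝ (fun y : Fin 4 → ℝ => spherePoint (y 2) (y 3)) y v) 0 := by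
    have h0 : HasFDerivAt (fun y : Fin 4 → ℝ => spherePoint (y 2) (y 3))
        (fderiv ℝ (fun y : Fin 4 → ℝ => spherePoint (y 2) (y 3)) y) (y + (0 : ℝ) • v) := by
      simpa using hd.hasFDerivAt
    exact h0.comp_hasDerivAt (0 : ℝ) hline
  have hproj : ∀ i : Fin 3, HasDerivAt
      (fun t : ℝ => spherePoint ((y + t • v) 2) ((y + t • v) 3) i)
      (fderiv ℝ (fun y : Fin 4 → ℝ => spherePoint (y 2) (y 3)) y v i) 0 := fun i =>
    ((EuclideanSpace.proj (𝕜 := ℝ) i).hasFDerivAt.comp_hasDerivAt (0 : ℝ) h1)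
  ext i
  refine (hproj i).unique ?_
  fin_cases i
  · have := (hcoord 2).sin.mul (hcoord 3).cos
    simp only [spherePoint]
    refine this.congr_deriv ?_
    simp
    ring
  · have := (hcoord 2).sin.mul (hcoord 3).sin
    simp only [spherePoint]
    refine this.congr_deriv ?_
    simp
    ring
  · have := (hcoord 2).cos
    simp only [spherePoint]
    refine this.congr_deriv ?_
    simp

theorem fderiv_comp_fst_two {F : Type*} [NormedAddCommGroup F] [NormedSpace ℝ F]
    {f : ℝ × ℝ → F} {y : Fin 4 → ℝ} (hf : DifferentiableAt ℝ f (y 0, y 1)) (v : Fin 4 → ℝ) :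
    DifferentiableAt ℝ (fun y : Fin 4 → ℝ => f (y 0, y 1)) y ∧
    fderiv ℝ (fun y : Fin 4 → ℝ => f (y 0, y 1)) y v = fderiv ℝ f (y 0, y 1) (v 0, v 1) := by
  have h1 : HasFDerivAt (fun y : Fin 4 → ℝ => (y 0, y 1))
      ((ContinuousLinearMap.proj (R := ℝ) (φ := fun _ : Fin 4 => ℝ) 0).prod
        (ContinuousLinearMap.proj (R := ℝ) (φ := fun _ : Fin 4 => ℝ) 1)) y :=
    (hasFDerivAt_apply 0 y).prodMk (hasFDerivAt_apply 1 y)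
  have h2 := HasFDerivAt.comp (f := fun y : Fin 4 → ℝ => (y 0, y 1)) y hf.hasFDerivAt h1
  refine ⟨h2.differentiableAt, ?_⟩
  have h3 : fderiv ℝ (fun y : Fin 4 → ℝ => f (y 0, y 1)) y = _ := h2.fderiv
  rw [h3]
  rfl

theorem fderiv_coordMap {X : ℝ × ℝ → ℝ × ℝ} {y : Fin 4 → ℝ}
    (hX : DifferentiableAt ℝ X (y 0, y 1)) (v : Fin 4 → ℝ) :
    fderiv ℝ (coordMap X) y v = (fderiv ℝ X (y 0, y 1) (v 0, v 1),
      !₂[cos (y 2) * cos (y 3) * v 2 - sin (y 2) * sin (y 3) * v 3,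
        cos (y 2) * sin (y 3) * v 2 + sin (y 2) * cos (y 3) * v 3, -sin (y 2) * v 2]) := by
  obtain ⟨h1, h2⟩ := fderiv_comp_fst_two hX v
  obtain ⟨h3, h4⟩ := fderiv_spherePoint_comp y v
  have := h1.hasFDerivAt.prodMk h3.hasFDerivAt
  rw [show fderiv ℝ (coordMap X) y = _ from this.fderiv, ContinuousLinearMap.prod_apply, h2, h4]

namespace SphericalSpacetime

variable {S : SphericalSpacetime} {x : ℝ × ℝ} {r : ℝ × ℝ → ℝ}

theorem metricMatrix_eq {X : ℝ × ℝ → ℝ × ℝ} {w : ℝ × ℝ} (hX : DifferentiableAt ℝ X w)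
    (hU : X w ∈ S.U) (θ φ : ℝ) :
    S.metricMatrix X ![w.1, w.2, θ, φ] =
      !![S.orbitMetric (X w) (fderiv ℝ X w (1, 0)) (fderiv ℝ X w (1, 0)),
          S.orbitMetric (X w) (fderiv ℝ X w (1, 0)) (fderiv ℝ X w (0, 1)), 0, 0;
        S.orbitMetric (X w) (fderiv ℝ X w (1, 0)) (fderiv ℝ X w (0, 1)),
          S.orbitMetric (X w) (fderiv ℝ X w (0, 1)) (fderiv ℝ X w (0, 1)), 0, 0;
        0, 0, S.orbitRadiusSq (X w), 0;
        0, 0, 0, S.orbitRadiusSq (X w) * sin θ ^ 2] := by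
  have hθ := sin_sq_add_cos_sq θ
  have hφ := sin_sq_add_cos_sq φ
  have key : ∀ u v : Fin 4 → ℝ, S.g (coordMap X ![w.1, w.2, θ, φ])
      (fderiv ℝ (coordMap X) ![w.1, w.2, θ, φ] u) (fderiv ℝ (coordMap X) ![w.1, w.2, θ, φ] v) =
      S.orbitMetric (X w) (fderiv ℝ X w (u 0, u 1)) (fderiv ℝ X w (v 0, v 1))
        + S.orbitRadiusSq (X w) * (u 2 * v 2 + sin θ ^ 2 * (u 3 * v 3)) := by
    intro u v
    have htan : ∀ u : Fin 4 → ℝ, ⟪spherePoint θ φ, (!₂[cos θ * cos φ * u 2 - sin θ * sin φ * u 3,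
        cos θ * sin φ * u 2 + sin θ * cos φ * u 3, -sin θ * u 2] : E3)⟫ = 0 := by
      intro u
      rw [inner_E3]
      simp [spherePoint]
      linear_combination sin θ * cos θ * u 2 * hφ
    rw [fderiv_coordMap (y := ![w.1, w.2, θ, φ]) hX, fderiv_coordMap (y := ![w.1, w.2, θ, φ]) hX]
    have := g_eq hU (spherePoint_mem θ φ)
      (u := (fderiv ℝ X w (u 0, u 1), !₂[cos θ * cos φ * u 2 - sin θ * sin φ * u 3,
        cos θ * sin φ * u 2 + sin θ * cos φ * u 3, -sin θ * u 2]))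
      (v := (fderiv ℝ X w (v 0, v 1), !₂[cos θ * cos φ * v 2 - sin θ * sin φ * v 3,
        cos θ * sin φ * v 2 + sin θ * cos φ * v 3, -sin θ * v 2])) (htan u) (htan v)
    refine this.trans ?_
    congr 2
    rw [inner_E3]
    simp
    linear_combination (cos θ ^ 2 * u 2 * v 2 + sin θ ^ 2 * u 3 * v 3) * hφ + u 2 * v 2 * hθ
  ext i j
  rw [metricMatrix, Matrix.of_apply, key]
  have h00 : ((0 : ℝ), (0 : ℝ)) = 0 := rfl
  fin_cases i <;> fin_cases j <;> simp [h00, orbitMetric_symm hU (fderiv ℝ X w (0, 1))]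

theorem metricMatrix_id (hx : x ∈ S.U) (θ φ : ℝ) :
    S.metricMatrix id ![x.1, x.2, θ, φ] =
      !![S.orbitMetric x (1, 0) (1, 0), S.orbitMetric x (1, 0) (0, 1), 0, 0;
        S.orbitMetric x (1, 0) (0, 1), S.orbitMetric x (0, 1) (0, 1), 0, 0;
        0, 0, S.orbitRadiusSq x, 0;
        0, 0, 0, S.orbitRadiusSq x * sin θ ^ 2] := by
  have := metricMatrix_eq (S := S) (X := id) (w := x) differentiableAt_id hx θ φ
  simpa only [fderiv_id, ContinuousLinearMap.id_apply, id_eq] using this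

theorem delta_eq (hx : x ∈ S.U) (θ φ : ℝ) : S.delta x θ φ = S.orbitDet x := by
  rw [delta, metricMatrix_id hx, orbitDet]
  simp

/-- `(dr)²` in terms of the metric of the orbit space. -/
noncomputable def orbitDrSq (S : SphericalSpacetime) (r : ℝ × ℝ → ℝ) (x : ℝ × ℝ) : ℝ :=
  (S.orbitMetric x (0, 1) (0, 1) * fderiv ℝ r x (1, 0) ^ 2
    - 2 * S.orbitMetric x (1, 0) (0, 1) * fderiv ℝ r x (1, 0) * fderiv ℝ r x (0, 1)
    + S.orbitMetric x (1, 0) (1, 0) * fderiv ℝ r x (0, 1) ^ 2) / S.orbitDet x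

/-- The metric matrix is block diagonal and `r` ignores the angles, so only the inverse of the orbit
block enters. The range of `θ` makes the full matrix invertible. -/
theorem drSq_eq (hx : x ∈ S.U) (hr : DifferentiableAt ℝ r x) {θ : ℝ} (h0 : 0 < θ) (hπ : θ < π)
    (φ : ℝ) : S.drSq r x θ φ = S.orbitDrSq r x := by
  have hδ : S.orbitDet x ≠ 0 := (orbitDet_neg hx).ne
  have hc : S.orbitRadiusSq x ≠ 0 := (orbitRadiusSq_pos hx).ne'
  have hs : sin θ ≠ 0 := (sin_pos_of_pos_of_lt_pi h0 hπ).ne'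
  have hinv : (S.metricMatrix id ![x.1, x.2, θ, φ])⁻¹ =
      !![S.orbitMetric x (0, 1) (0, 1) / S.orbitDet x,
          -S.orbitMetric x (1, 0) (0, 1) / S.orbitDet x, 0, 0;
        -S.orbitMetric x (1, 0) (0, 1) / S.orbitDet x,
          S.orbitMetric x (1, 0) (1, 0) / S.orbitDet x, 0, 0;
        0, 0, (S.orbitRadiusSq x)⁻¹, 0;
        0, 0, 0, (S.orbitRadiusSq x * sin θ ^ 2)⁻¹] := by
    refine Matrix.inv_eq_right_inv ?_
    rw [metricMatrix_id hx]
    ext i j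
    fin_cases i <;> fin_cases j <;>
      simp [Matrix.mul_apply, Fin.sum_univ_four] <;>
      field_simp <;> (try rw [orbitDet]) <;> ring
  have hd : ∀ v : Fin 4 → ℝ,
      fderiv ℝ (fun y : Fin 4 → ℝ => r (y 0, y 1)) ![x.1, x.2, θ, φ] v =
        fderiv ℝ r x (v 0, v 1) :=
    fun v => (fderiv_comp_fst_two (y := ![x.1, x.2, θ, φ]) hr v).2
  have h00 : ((0 : ℝ), (0 : ℝ)) = 0 := rfl
  simp only [drSq, hinv, hd, Fin.sum_univ_four, orbitDrSq]
  simp [h00]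
  field_simp
  ring

end SphericalSpacetime

/-! ### Charts with second coordinate `r`, and the quadratic equation -/

theorem clm_prod_apply {F : Type*} [NormedAddCommGroup F] [NormedSpace ℝ F]
    (D : ℝ × ℝ →L[ℝ] F) (u : ℝ × ℝ) : D u = u.1 • D (1, 0) + u.2 • D (0, 1) := by
  conv_lhs => rw [show u = u.1 • ((1 : ℝ), (0 : ℝ)) + u.2 • ((0 : ℝ), (1 : ℝ)) by ext <;> simp]
  rw [map_add, map_smul, map_smul]

theorem jac_comp {f g : ℝ × ℝ → ℝ × ℝ} {w : ℝ × ℝ} (hf : DifferentiableAt ℝ f (g w))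
    (hg : DifferentiableAt ℝ g w) : jac (fun z => f (g z)) w = jac f (g w) * jac g w := by
  have h : ∀ v, fderiv ℝ (fun z => f (g z)) w v = fderiv ℝ f (g w) (fderiv ℝ g w v) := by
    intro v
    rw [show fderiv ℝ (fun z => f (g z)) w = _ from fderiv_comp w hf hg]
    rfl
  simp only [jac, h]
  rw [clm_prod_apply _ (fderiv ℝ g w (1, 0)), clm_prod_apply _ (fderiv ℝ g w (0, 1))]
  simp only [Prod.fst_add, Prod.snd_add, Prod.smul_fst, Prod.smul_snd, smul_eq_mul]
  ring

/-- Cramer's rule gives injectivity; the inverse function theorem needs the differential as an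
equivalence. -/
theorem exists_equiv_of_jac_ne_zero {X : ℝ × ℝ → ℝ × ℝ} {w : ℝ × ℝ} (h : jac X w ≠ 0) :
    ∃ e : (ℝ × ℝ) ≃L[ℝ] ℝ × ℝ, (e : ℝ × ℝ →L[ℝ] ℝ × ℝ) = fderiv ℝ X w := by
  have hinj : Function.Injective (fderiv ℝ X w : ℝ × ℝ →ₗ[ℝ] ℝ × ℝ) := by
    rw [injective_iff_map_eq_zero]
    intro u hu
    have hu' : fderiv ℝ X w u = 0 := hu
    rw [clm_prod_apply] at hu'
    have h1 := congrArg Prod.fst hu'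
    have h2 := congrArg Prod.snd hu'
    simp only [Prod.fst_add, Prod.snd_add, Prod.smul_fst, Prod.smul_snd, smul_eq_mul,
      Prod.fst_zero, Prod.snd_zero] at h1 h2
    have e1 : jac X w * u.1 = 0 := by
      unfold jac
      linear_combination (fderiv ℝ X w (0, 1)).2 * h1 - (fderiv ℝ X w (0, 1)).1 * h2
    have e2 : jac X w * u.2 = 0 := by
      unfold jac
      linear_combination (fderiv ℝ X w (1, 0)).1 * h2 - (fderiv ℝ X w (1, 0)).2 * h1
    exact Prod.ext ((mul_eq_zero.1 e1).resolve_left h) ((mul_eq_zero.1 e2).resolve_left h)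
  exact ⟨(LinearEquiv.ofInjectiveEndo _ hinj).toContinuousLinearEquiv, by ext <;> rfl⟩

theorem contDiffOn_fderiv_apply {E F : Type*} [NormedAddCommGroup E] [NormedSpace ℝ E]
    [NormedAddCommGroup F] [NormedSpace ℝ F] {f : E → F} {V : Set E} (hV : IsOpen V)
    (hf : ContDiffOn ℝ ∞ f V) (v : E) : ContDiffOn ℝ ∞ (fun x => fderiv ℝ f x v) V :=
  (hf.fderiv_of_isOpen hV (m := ∞) (by norm_cast)).clm_apply contDiffOn_const

/-- Around a point where its differential does not vanish, a smooth function on the plane is the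
second coordinate of a smooth chart. -/
theorem exists_chart_snd_eq {r : ℝ × ℝ → ℝ} {V : Set (ℝ × ℝ)} (hV : IsOpen V)
    (hr : ContDiffOn ℝ ∞ r V) {p : ℝ × ℝ} (hp : p ∈ V) (hdr : fderiv ℝ r p ≠ 0) :
    ∃ (O : Set (ℝ × ℝ)) (Y : ℝ × ℝ → ℝ × ℝ) (q : ℝ × ℝ), IsOpen O ∧ q ∈ O ∧ Y q = p ∧
      MapsTo Y O V ∧ ContDiffOn ℝ ∞ Y O ∧ InjOn Y O ∧ (∀ w ∈ O, jac Y w ≠ 0) ∧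
      ∀ w ∈ O, r (Y w) = w.2 := by
  set α := fderiv ℝ r p (1, 0) with hα
  set β := fderiv ℝ r p (0, 1) with hβ
  have hαβ : α ^ 2 + β ^ 2 ≠ 0 := by
    intro h
    have h1 : α = 0 := by nlinarith [sq_nonneg α, sq_nonneg β]
    have h2 : β = 0 := by nlinarith [sq_nonneg α, sq_nonneg β]
    refine hdr (ContinuousLinearMap.ext fun u => ?_)
    rw [clm_prod_apply, ← hα, ← hβ, h1, h2]
    simp
  -- The first component is linear with gradient orthogonal to that of `r` at `p`, so the Jacobian
  -- at `p` is `-(α² + β²) ≠ 0`.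
  set ψ : ℝ × ℝ → ℝ × ℝ := fun y => (-β * y.1 + α * y.2, r y) with hψ
  have hψs : ContDiffOn ℝ ∞ ψ V := by
    refine ContDiffOn.prodMk ?_ hr
    fun_prop
  have hrd : ∀ y ∈ V, DifferentiableAt ℝ r y := fun y hy =>
    (hr.contDiffAt (hV.mem_nhds hy)).differentiableAt (by simp)
  have hjac : ∀ y ∈ V, jac ψ y = -β * fderiv ℝ r y (0, 1) - α * fderiv ℝ r y (1, 0) := by
    intro y hy
    have h1 : HasFDerivAt (fun y : ℝ × ℝ => -β * y.1 + α * y.2)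
        ((-β) • ContinuousLinearMap.fst ℝ ℝ ℝ + α • ContinuousLinearMap.snd ℝ ℝ ℝ) y :=
      (hasFDerivAt_fst.const_mul (-β)).add (hasFDerivAt_snd.const_mul α)
    have h2 := h1.prodMk (hrd y hy).hasFDerivAt
    rw [jac, show fderiv ℝ ψ y = _ from h2.fderiv]
    simp
  have hjc : ContinuousOn (jac ψ) V := by
    have h1 := (contDiffOn_fderiv_apply hV hr (1, 0)).continuousOn
    have h2 := (contDiffOn_fderiv_apply hV hr (0, 1)).continuousOn
    exact ContinuousOn.congr (by fun_prop) hjac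
  -- On `V'` the differential stays invertible, which makes the local inverse smooth at every point
  -- of the chart and not only at `ψ p`.
  set V' := V ∩ jac ψ ⁻¹' {0}ᶜ with hV'
  have hV'o : IsOpen V' := hjc.isOpen_inter_preimage hV isOpen_compl_singleton
  have hpV' : p ∈ V' := by
    refine ⟨hp, fun h => hαβ ?_⟩
    have : jac ψ p = 0 := h
    rw [hjac p hp, ← hα, ← hβ] at this
    linarith
  have hψc : ∀ y ∈ V, ContDiffAt ℝ ∞ ψ y := fun y hy => hψs.contDiffAt (hV.mem_nhds hy)
  have hψd : ∀ y ∈ V, DifferentiableAt ℝ ψ y := fun y hy => (hψc y hy).differentiableAt (by simp)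
  obtain ⟨D, hD⟩ := exists_equiv_of_jac_ne_zero hpV'.2
  set e := (hψc p hp).toOpenPartialHomeomorph ψ (f' := D)
    (by rw [hD]; exact (hψd p hp).hasFDerivAt) (by simp) with he
  have hpe : p ∈ e.source := ContDiffAt.mem_toOpenPartialHomeomorph_source _ _ _
  have hecoe : ∀ y, e y = ψ y := fun _ => rfl
  refine ⟨e.target ∩ e.symm ⁻¹' V', e.symm, ψ p, e.isOpen_inter_preimage_symm hV'o,
    ⟨e.map_source hpe, ?_⟩, e.left_inv hpe, fun w hw => hw.2.1, ?_,
    e.symm.injOn.mono inter_subset_left, ?_, ?_⟩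
  · have : e.symm (ψ p) = p := e.left_inv hpe
    rw [mem_preimage, this]
    exact hpV'
  · intro w hw
    obtain ⟨D', hD'⟩ := exists_equiv_of_jac_ne_zero hw.2.2
    exact (e.contDiffAt_symm (f₀' := D') hw.1 (by rw [hD']; exact (hψd _ hw.2.1).hasFDerivAt)
      (hψc _ hw.2.1)).contDiffWithinAt
  · intro w hw h0
    obtain ⟨D', hD'⟩ := exists_equiv_of_jac_ne_zero hw.2.2
    have hd : DifferentiableAt ℝ e.symm w :=
      (e.contDiffAt_symm (f₀' := D') hw.1 (by rw [hD']; exact (hψd _ hw.2.1).hasFDerivAt)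
        (hψc _ hw.2.1)).differentiableAt (by simp)
    have h1 := jac_comp (hψd _ hw.2.1) hd
    have h2 : (fun z => ψ (e.symm z)) =ᶠ[𝓝 w] id := by
      filter_upwards [e.open_target.mem_nhds hw.1] with z hz using e.right_inv hz
    rw [h0, mul_zero, jac, h2.fderiv_eq] at h1
    simp at h1
  · intro w hw
    exact congrArg Prod.snd (e.right_inv hw.1)

/-- Smooth solution `l` of the quadratic equation `a l² + 2 b l + c = 1`, given a smooth square
root `d` of its discriminant. -/
theorem exists_smooth_root {a b c d : ℝ × ℝ → ℝ} {O : Set (ℝ × ℝ)} (hO : IsOpen O)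
    (ha : ContDiffOn ℝ ∞ a O) (hb : ContDiffOn ℝ ∞ b O) (hc : ContDiffOn ℝ ∞ c O)
    (hd : ContDiffOn ℝ ∞ d O) (hD : ∀ z ∈ O, d z ^ 2 = b z ^ 2 - a z * (c z - 1)) {q : ℝ × ℝ}
    (hq : q ∈ O) (h0 : a q ≠ 0 ∨ b q + d q ≠ 0) :
    ∃ (O' : Set (ℝ × ℝ)) (l : ℝ × ℝ → ℝ), IsOpen O' ∧ q ∈ O' ∧ O' ⊆ O ∧ ContDiffOn ℝ ∞ l O' ∧
      ∀ z ∈ O', l z ^ 2 * a z + 2 * l z * b z + c z = 1 ∧ l z * a z + b z = d z := by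
  rcases h0 with h0 | h0
  · refine ⟨O ∩ a ⁻¹' {0}ᶜ, fun z => (d z - b z) / a z,
      ha.continuousOn.isOpen_inter_preimage hO isOpen_compl_singleton, ⟨hq, h0⟩, inter_subset_left,
      ((hd.sub hb).mono inter_subset_left).div (ha.mono inter_subset_left) fun z hz => hz.2, ?_⟩
    intro z hz
    have hz0 : a z ≠ 0 := hz.2
    have := hD z hz.1
    constructor
    · field_simp
      linear_combination this
    · field_simp
      ring
  -- The same root with rationalized numerator: it stays smooth across zeros of `a`, as long as `b +
  -- d ≠ 0`.
  · have hbd := hb.add hd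
    refine ⟨O ∩ (fun z => b z + d z) ⁻¹' {0}ᶜ, fun z => (1 - c z) / (b z + d z),
      hbd.continuousOn.isOpen_inter_preimage hO isOpen_compl_singleton, ⟨hq, h0⟩, inter_subset_left,
      ((contDiffOn_const.sub hc).mono inter_subset_left).div (hbd.mono inter_subset_left)
        fun z hz => hz.2, ?_⟩
    intro z hz
    have hz0 : b z + d z ≠ 0 := hz.2
    have := hD z hz.1
    constructor
    · field_simp
      linear_combination (c z - 1) * this
    · field_simp
      linear_combination -this

/-! ### Painlevé–Gullstrand charts -/

namespace SphericalSpacetime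

variable {S : SphericalSpacetime} {x : ℝ × ℝ} {r : ℝ × ℝ → ℝ}

theorem IsOrbitRadius.differentiableAt (hr : S.IsOrbitRadius r) (hx : x ∈ S.U) :
    DifferentiableAt ℝ r x :=
  (hr.contDiffOn.contDiffAt (S.isOpen_U.mem_nhds hx)).differentiableAt (by simp)

theorem contDiffOn_orbitDet (S : SphericalSpacetime) : ContDiffOn ℝ ∞ S.orbitDet S.U :=
  ((S.contDiffOn_orbitMetric _ _).mul (S.contDiffOn_orbitMetric _ _)).sub
    ((S.contDiffOn_orbitMetric _ _).pow 2)

theorem IsOrbitRadius.contDiffOn_orbitDrSq (hr : S.IsOrbitRadius r) :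
    ContDiffOn ℝ ∞ (S.orbitDrSq r) S.U := by
  have h1 := contDiffOn_fderiv_apply S.isOpen_U hr.contDiffOn (1, 0)
  have h2 := contDiffOn_fderiv_apply S.isOpen_U hr.contDiffOn (0, 1)
  have h3 := S.contDiffOn_orbitMetric (1, 0) (1, 0)
  have h4 := S.contDiffOn_orbitMetric (1, 0) (0, 1)
  have h5 := S.contDiffOn_orbitMetric (0, 1) (0, 1)
  exact ContDiffOn.div (by fun_prop) S.contDiffOn_orbitDet fun x hx => (orbitDet_neg hx).ne

/-- Metric components in coordinates of the orbit space whose second coordinate is `r`. -/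
theorem orbitMetric_curvature_coordinates {X : ℝ × ℝ → ℝ × ℝ} {w : ℝ × ℝ}
    (hX : DifferentiableAt ℝ X w) (hU : X w ∈ S.U) (hr : DifferentiableAt ℝ r (X w))
    (hrX : ∀ᶠ z in 𝓝 w, r (X z) = z.2) :
    S.orbitMetric (X w) (fderiv ℝ X w (1, 0)) (fderiv ℝ X w (1, 0)) =
      jac X w ^ 2 * S.orbitDet (X w) * S.orbitDrSq r (X w) ∧
    S.orbitMetric (X w) (fderiv ℝ X w (1, 0)) (fderiv ℝ X w (1, 0)) *
        S.orbitMetric (X w) (fderiv ℝ X w (0, 1)) (fderiv ℝ X w (0, 1)) -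
      S.orbitMetric (X w) (fderiv ℝ X w (1, 0)) (fderiv ℝ X w (0, 1)) ^ 2 =
      jac X w ^ 2 * S.orbitDet (X w) := by
  have h : ∀ v : ℝ × ℝ, fderiv ℝ r (X w) (fderiv ℝ X w v) = v.2 := by
    intro v
    have h1 : fderiv ℝ (fun z => r (X z)) w = _ := fderiv_comp w hr hX
    have h2 : (fun z => r (X z)) =ᶠ[𝓝 w] Prod.snd := hrX
    rw [h2.fderiv_eq, fderiv_snd] at h1
    exact (congrArg (fun D : ℝ × ℝ →L[ℝ] ℝ => D v) h1).symm
  have ht := h (1, 0)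
  have hs := h (0, 1)
  rw [clm_prod_apply, smul_eq_mul, smul_eq_mul] at ht hs
  have hδ : S.orbitDet (X w) ≠ 0 := (orbitDet_neg hU).ne
  constructor
  -- Solving the chain rule for `r ∘ X = Prod.snd` by Cramer's rule expresses `∂ₜX` through `J dr`;
  -- the first metric component then becomes the numerator of `(dr)²`.
  · have e1 : jac X w * fderiv ℝ r (X w) (1, 0) = -(fderiv ℝ X w (1, 0)).2 := by
      rw [jac]
      linear_combination (fderiv ℝ X w (0, 1)).2 * ht - (fderiv ℝ X w (1, 0)).2 * hs
    have e2 : jac X w * fderiv ℝ r (X w) (0, 1) = (fderiv ℝ X w (1, 0)).1 := by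
      rw [jac]
      linear_combination (fderiv ℝ X w (1, 0)).1 * hs - (fderiv ℝ X w (0, 1)).1 * ht
    rw [orbitMetric_expand hU, ← e2, show (fderiv ℝ X w (1, 0)).2 =
      -(jac X w * fderiv ℝ r (X w) (1, 0)) by linarith, orbitDrSq]
    field_simp
    ring
  · rw [orbitMetric_expand hU (fderiv ℝ X w (1, 0)) (fderiv ℝ X w (1, 0)),
      orbitMetric_expand hU (fderiv ℝ X w (0, 1)) (fderiv ℝ X w (0, 1)),
      orbitMetric_expand hU (fderiv ℝ X w (1, 0)) (fderiv ℝ X w (0, 1)), jac, orbitDet]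
    ring

theorem IsPGChart.relations {W : Set (ℝ × ℝ)} {X : ℝ × ℝ → ℝ × ℝ} {A B : ℝ × ℝ → ℝ}
    (hr : S.IsOrbitRadius r) (h : S.IsPGChart r W X A B) {w : ℝ × ℝ} (hw : w ∈ W) :
    A w = jac X w ^ 2 * S.orbitDet (X w) * S.orbitDrSq r (X w) ∧
    B w ^ 2 = jac X w ^ 2 * (S.orbitDet (X w) * (S.orbitDrSq r (X w) - 1)) := by
  have hU := h.mapsTo hw
  have hX : DifferentiableAt ℝ X w :=
    (h.smooth.contDiffAt (h.isOpen.mem_nhds hw)).differentiableAt (by simp)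
  obtain ⟨h1, h2⟩ := orbitMetric_curvature_coordinates hX hU (hr.differentiableAt hU)
    (by filter_upwards [h.isOpen.mem_nhds hw] with z hz using h.radius z hz)
  have hm := h.metric w hw (π / 2) 0 (by positivity) (by linarith [pi_pos])
  rw [metricMatrix_eq hX hU] at hm
  have ha := congrFun (congrFun hm 0) 0
  have hb := congrFun (congrFun hm 0) 1
  have hc := congrFun (congrFun hm 1) 1
  simp at ha hb hc
  rw [ha] at h1
  rw [ha, hb, hc] at h2
  exact ⟨h1, by linear_combination h1 - h2⟩

/-- The radicand is nonnegative automatically, since `ℬ²` is `J²` times it and `J ≠ 0`. -/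
theorem pgRelations_of_eq {W : Set (ℝ × ℝ)} {X : ℝ × ℝ → ℝ × ℝ} {A B ε : ℝ × ℝ → ℝ}
    (hr : S.IsOrbitRadius r) (h : S.IsPGChart r W X A B)
    (hB : ∀ w ∈ W, B w = ε w * jac X w * √(S.orbitDet (X w) * (S.orbitDrSq r (X w) - 1))) :
    S.PGRelations r W X A B ε := by
  intro w hw θ φ h0 hπ
  have hU := h.mapsTo hw
  obtain ⟨h1, h2⟩ := h.relations hr hw
  rw [delta_eq hU, drSq_eq hU (hr.differentiableAt hU) h0 hπ]
  refine ⟨?_, h1, hB w hw⟩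
  have hJ : 0 < jac X w ^ 2 := by have := h.jac_ne_zero w hw; positivity
  exact nonneg_of_mul_nonneg_right (h2 ▸ sq_nonneg (B w)) hJ

theorem exists_pgRelations {W : Set (ℝ × ℝ)} {X : ℝ × ℝ → ℝ × ℝ} {A B : ℝ × ℝ → ℝ}
    (hr : S.IsOrbitRadius r) (h : S.IsPGChart r W X A B) :
    ∃ ε : ℝ × ℝ → ℝ, (∀ w ∈ W, ε w = 1 ∨ ε w = -1) ∧ S.PGRelations r W X A B ε := by
  have key : ∀ w ∈ W, ∃ ε : ℝ, (ε = 1 ∨ ε = -1) ∧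
      B w = ε * jac X w * √(S.orbitDet (X w) * (S.orbitDrSq r (X w) - 1)) := by
    intro w hw
    obtain ⟨-, h2⟩ := h.relations hr hw
    have hJ : 0 < jac X w ^ 2 := by have := h.jac_ne_zero w hw; positivity
    have h3 : B w ^ 2 = (jac X w * √(S.orbitDet (X w) * (S.orbitDrSq r (X w) - 1))) ^ 2 := by
      rw [mul_pow, sq_sqrt (nonneg_of_mul_nonneg_right (h2 ▸ sq_nonneg (B w)) hJ), h2]
    rcases sq_eq_sq_iff_eq_or_eq_neg.1 h3 with h4 | h4
    · exact ⟨1, Or.inl rfl, by rw [h4]; ring⟩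
    · exact ⟨-1, Or.inr rfl, by rw [h4]; ring⟩
  choose! ε hε hB using key
  exact ⟨ε, hε, pgRelations_of_eq hr h hB⟩

/-- Painlevé–Gullstrand coordinates from curvature coordinates `Y` of the orbit space and a smooth
root `d` of the discriminant. -/
theorem exists_isPGChart (hr : S.IsOrbitRadius r) {O : Set (ℝ × ℝ)} {Y : ℝ × ℝ → ℝ × ℝ}
    {q : ℝ × ℝ} (hO : IsOpen O) (hq : q ∈ O) (hYU : MapsTo Y O S.U) (hY : ContDiffOn ℝ ∞ Y O)
    (hinj : InjOn Y O) (hjac : ∀ w ∈ O, jac Y w ≠ 0) (hrY : ∀ w ∈ O, r (Y w) = w.2)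
    {d : ℝ × ℝ → ℝ} (hd : ContDiffOn ℝ ∞ d O)
    (hD : ∀ z ∈ O, d z ^ 2 = jac Y z ^ 2 * (S.orbitDet (Y z) * (S.orbitDrSq r (Y z) - 1)))
    (h0 : S.orbitDrSq r (Y q) ≠ 0 ∨
      S.orbitMetric (Y q) (fderiv ℝ Y q (1, 0)) (fderiv ℝ Y q (0, 1)) + d q ≠ 0) :
    ∃ (W : Set (ℝ × ℝ)) (X : ℝ × ℝ → ℝ × ℝ) (A B : ℝ × ℝ → ℝ),
      S.IsPGChart r W X A B ∧ Y q ∈ X '' W ∧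
      ∀ w ∈ W, ∃ z ∈ O, X w = Y z ∧ B w = jac X w * (d z / jac Y z) := by
  have hYd : ∀ z ∈ O, DifferentiableAt ℝ Y z := fun z hz =>
    (hY.contDiffAt (hO.mem_nhds hz)).differentiableAt (by simp)
  set comp : ℝ × ℝ → ℝ × ℝ → ℝ × ℝ → ℝ := fun u v z =>
    S.orbitMetric (Y z) (fderiv ℝ Y z u) (fderiv ℝ Y z v) with hcomp
  have hcs : ∀ u v, ContDiffOn ℝ ∞ (comp u v) O := by
    intro u v
    have h1 := contDiffOn_fderiv_apply hO hY u
    have h2 := contDiffOn_fderiv_apply hO hY v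
    have h3 : ∀ a b, ContDiffOn ℝ ∞ (fun z => S.orbitMetric (Y z) a b) O := fun a b =>
      (S.contDiffOn_orbitMetric a b).comp hY hYU
    refine ContDiffOn.congr ?_ fun z hz => orbitMetric_expand (hYU hz) _ _
    have h4 := h3 (1, 0) (1, 0)
    have h5 := h3 (1, 0) (0, 1)
    have h6 := h3 (0, 1) (0, 1)
    fun_prop
  have hid : ∀ z ∈ O, _ := fun z hz => orbitMetric_curvature_coordinates (hYd z hz) (hYU hz)
    (hr.differentiableAt (hYU hz)) (by filter_upwards [hO.mem_nhds hz] with z hz using hrY z hz)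
  -- The discriminant is `b² - a(c - 1) = a - (ac - b²)`, a difference of the two quantities in
  -- `hid`; also `a ≠ 0` at `q` as soon as `(dr)² ≠ 0` there.
  obtain ⟨O₁, l, hO₁, hqO₁, hO₁O, hl, hroot⟩ := exists_smooth_root hO (hcs (1, 0) (1, 0))
    (hcs (1, 0) (0, 1)) (hcs (0, 1) (0, 1)) hd
    (fun z hz => by
      rw [hD z hz]
      obtain ⟨h1, h2⟩ := hid z hz
      simp only [hcomp]
      linear_combination h2 - h1) hq
    (h0.imp_left fun hk => by
      simp only [hcomp]
      rw [(hid q hq).1]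
      exact mul_ne_zero (mul_ne_zero (pow_ne_zero _ (hjac q hq)) (orbitDet_neg (hYU hq)).ne) hk)
  -- The new time labels the integral curves of `l`: moving along `r` at fixed `t` follows the
  -- direction of unit length found above.
  obtain ⟨O₂, Φ, hO₂, hqO₂, hO₂O, hΦ, hΦq, hflow⟩ := exists_local_flow hO₁ hl hqO₁
  set σ : ℝ × ℝ → ℝ × ℝ := fun w => (Φ w, w.2) with hσ
  have hσs : ContDiff ℝ ∞ σ := hΦ.prodMk contDiff_snd
  have hΦd : Differentiable ℝ Φ := hΦ.differentiable (by simp)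
  have hσd : ∀ w v, fderiv ℝ σ w v = (fderiv ℝ Φ w v, v.2) := by
    intro w v
    rw [show fderiv ℝ σ w = _ from ((hΦd w).hasFDerivAt.prodMk hasFDerivAt_snd).fderiv]
    rfl
  have hσdiff : Differentiable ℝ σ := hσs.differentiable (by simp)
  have hσinj : Function.Injective σ := by
    rintro ⟨t, s⟩ ⟨t', s'⟩ h
    obtain rfl : s = s' := congrArg Prod.snd h
    have hmono : StrictMono fun t => Φ (t, s) := strictMono_of_deriv_pos fun t => by
      rw [(hasDerivAt_partial_fst (hΦd (t, s))).deriv]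
      exact (hflow (t, s)).1
    rw [hmono.injective (congrArg Prod.fst h)]
  set X : ℝ × ℝ → ℝ × ℝ := fun w => Y (σ w) with hX
  have hWO : MapsTo σ (σ ⁻¹' O₂) O := fun w hw => hO₁O (hO₂O hw)
  have hXd : ∀ w ∈ σ ⁻¹' O₂, ∀ v, fderiv ℝ X w v = fderiv ℝ Y (σ w) (fderiv ℝ Φ w v, v.2) := by
    intro w hw v
    rw [show fderiv ℝ X w = _ from fderiv_comp w (hYd _ (hWO hw)) (hσdiff w), ← hσd]
    rfl
  have hXt : ∀ w ∈ σ ⁻¹' O₂, fderiv ℝ X w (1, 0) =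
      fderiv ℝ Φ w (1, 0) • fderiv ℝ Y (σ w) (1, 0) := by
    intro w hw
    rw [hXd w hw, clm_prod_apply]
    simp
  have hXr : ∀ w ∈ σ ⁻¹' O₂, fderiv ℝ X w (0, 1) =
      l (σ w) • fderiv ℝ Y (σ w) (1, 0) + fderiv ℝ Y (σ w) (0, 1) := by
    intro w hw
    rw [hXd w hw, clm_prod_apply, (hflow w).2 hw]
    simp [hσ]
  have hXj : ∀ w ∈ σ ⁻¹' O₂, jac X w = jac Y (σ w) * fderiv ℝ Φ w (1, 0) := by
    intro w hw
    rw [hX, jac_comp (hYd _ (hWO hw)) (hσdiff w)]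
    simp [jac, hσd]
  have hXdiff : ∀ w ∈ σ ⁻¹' O₂, DifferentiableAt ℝ X w := fun w hw =>
    DifferentiableAt.comp w (hYd _ (hWO hw)) (hσdiff w)
  have hXrr : ∀ w ∈ σ ⁻¹' O₂,
      S.orbitMetric (X w) (fderiv ℝ X w (0, 1)) (fderiv ℝ X w (0, 1)) = 1 := by
    intro w hw
    rw [hXr w hw]
    refine Eq.trans ?_ (hroot _ (hO₂O hw)).1
    simp only [map_add, map_smul, LinearMap.add_apply, LinearMap.smul_apply, smul_eq_mul, hX, hcomp]
    rw [orbitMetric_symm (hYU (hWO hw)) (fderiv ℝ Y (σ w) (0, 1)) (fderiv ℝ Y (σ w) (1, 0))]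
    ring
  have hXrad : ∀ w ∈ σ ⁻¹' O₂, r (X w) = w.2 := fun w hw => hrY _ (hWO hw)
  refine ⟨σ ⁻¹' O₂, X,
    fun w => S.orbitMetric (X w) (fderiv ℝ X w (1, 0)) (fderiv ℝ X w (1, 0)),
    fun w => S.orbitMetric (X w) (fderiv ℝ X w (1, 0)) (fderiv ℝ X w (0, 1)),
    ⟨hO₂.preimage hσs.continuous, fun w hw => hYU (hWO hw), hY.comp hσs.contDiffOn hWO,
      fun w hw w' hw' h => hσinj (hinj (hWO hw) (hWO hw') h), fun w hw => ?_, hXrad,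
      fun w hw θ φ _ _ => ?_⟩, ⟨q, ?_, ?_⟩, fun w hw => ⟨σ w, hWO hw, rfl, ?_⟩⟩
  · rw [hXj w hw]
    exact mul_ne_zero (hjac _ (hWO hw)) (hflow w).1.ne'
  · rw [metricMatrix_eq (hXdiff w hw) (hYU (hWO hw)), hXrr w hw,
      ← (isOrbitRadius_iff.1 hr _ (hYU (hWO hw))).2, hXrad w hw]
  · simpa [hσ, hΦq] using hqO₂
  · simp [hX, hσ, hΦq]
  -- The mixed component is `Φₜ(l a + b) = Φₜ d`, and `Φₜ` is the quotient of the Jacobians of `X`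
  -- and `Y`.
  · beta_reduce
    rw [hXj w hw, ← (hroot _ (hO₂O hw)).2, hXt w hw, hXr w hw]
    have := hjac _ (hWO hw)
    simp only [map_add, map_smul, LinearMap.smul_apply, smul_eq_mul, hX, hcomp]
    field_simp

/-- The discriminant is positive, so `d = ε J √(δ((dr)² - 1))` is smooth for both signs. Since `d ≠
0`, the numbers `b + d` and `b - d` cannot both vanish, which leaves at least one usable sign when
`(dr)² = 0`. -/
theorem exists_isPGChart_of_lt_one (hr : S.IsOrbitRadius r) {p : ℝ × ℝ} (hp : p ∈ S.U)
    (hdr : fderiv ℝ r p ≠ 0) (hk : S.orbitDrSq r p < 1) :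
    ∃ ε₀ : ℝ, (ε₀ = 1 ∨ ε₀ = -1) ∧ ∀ ε : ℝ, (ε = 1 ∨ ε = -1) →
      (S.orbitDrSq r p ≠ 0 ∨ ε = ε₀) →
      ∃ (W : Set (ℝ × ℝ)) (X : ℝ × ℝ → ℝ × ℝ) (A B : ℝ × ℝ → ℝ),
        S.IsPGChart r W X A B ∧ p ∈ X '' W ∧ S.PGRelations r W X A B (fun _ => ε) := by
  have hks := hr.contDiffOn_orbitDrSq
  have hV : IsOpen (S.U ∩ S.orbitDrSq r ⁻¹' Iio 1) :=
    hks.continuousOn.isOpen_inter_preimage S.isOpen_U isOpen_Iio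
  obtain ⟨O, Y, q, hO, hq, rfl, hYV, hY, hinj, hjac, hrY⟩ := exists_chart_snd_eq hV
    (hr.contDiffOn.mono inter_subset_left) ⟨hp, hk⟩ hdr
  have hYU : MapsTo Y O S.U := fun z hz => (hYV hz).1
  have hpos : ∀ z ∈ O, 0 < S.orbitDet (Y z) * (S.orbitDrSq r (Y z) - 1) := fun z hz =>
    mul_pos_of_neg_of_neg (orbitDet_neg (hYU hz)) (sub_neg.2 (hYV hz).2)
  set m : ℝ × ℝ → ℝ := fun z => √(S.orbitDet (Y z) * (S.orbitDrSq r (Y z) - 1)) with hm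
  have hms : ContDiffOn ℝ ∞ m O :=
    ((S.contDiffOn_orbitDet.comp hY hYU).mul ((hks.comp hY hYU).sub contDiffOn_const)).sqrt
      fun z hz => (hpos z hz).ne'
  have hjs : ContDiffOn ℝ ∞ (jac Y) O :=
    ((contDiffOn_fderiv_apply hO hY _).fst.mul (contDiffOn_fderiv_apply hO hY _).snd).sub
      ((contDiffOn_fderiv_apply hO hY _).fst.mul (contDiffOn_fderiv_apply hO hY _).snd)
  have hsign : ∃ ε₀ : ℝ, (ε₀ = 1 ∨ ε₀ = -1) ∧
      S.orbitMetric (Y q) (fderiv ℝ Y q (1, 0)) (fderiv ℝ Y q (0, 1)) + ε₀ * jac Y q * m q ≠ 0 := by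
    by_cases h : S.orbitMetric (Y q) (fderiv ℝ Y q (1, 0)) (fderiv ℝ Y q (0, 1))
        + 1 * jac Y q * m q = 0
    · refine ⟨-1, Or.inr rfl, fun h' => ?_⟩
      have : jac Y q * m q = 0 := by linarith
      exact mul_ne_zero (hjac q hq) (sqrt_pos.2 (hpos q hq)).ne' this
    · exact ⟨1, Or.inl rfl, h⟩
  obtain ⟨ε₀, hε₀, hne⟩ := hsign
  refine ⟨ε₀, hε₀, fun ε hε hor => ?_⟩
  have hε2 : ε ^ 2 = 1 := by rcases hε with rfl | rfl <;> norm_num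
  obtain ⟨W, X, A, B, hPG, hpW, hB⟩ := exists_isPGChart hr hO hq hYU hY hinj hjac hrY
    (d := fun z => ε * jac Y z * m z) ((contDiffOn_const.mul hjs).mul hms)
    (fun z hz => by
      have := sq_sqrt (hpos z hz).le
      rw [mul_pow, mul_pow, hε2, hm]
      simp only [this, one_mul])
    (hor.imp_right fun h => by rw [h]; exact hne)
  refine ⟨W, X, A, B, hPG, hpW, pgRelations_of_eq hr hPG fun w hw => ?_⟩
  obtain ⟨z, hz, hXz, hBz⟩ := hB w hw
  have := hjac z hz
  rw [hBz, hXz]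
  simp only [hm]
  field_simp

/-- At `p` the leading coefficient `a` is nonzero because `(dr)² = 1`, and `d = J √(-δ) s` is a
smooth root. As `s` may change sign, `ε` is only chosen pointwise. -/
theorem exists_isPGChart_of_eq_one (hr : S.IsOrbitRadius r) {p : ℝ × ℝ}
    (hk : S.orbitDrSq r p = 1) {V : Set (ℝ × ℝ)} {s : ℝ × ℝ → ℝ} (hV : IsOpen V) (hpV : p ∈ V)
    (hVU : V ⊆ S.U) (hs : ContDiffOn ℝ ∞ s V) (hsq : ∀ x ∈ V, 1 - S.orbitDrSq r x = s x ^ 2) :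
    ∃ (W : Set (ℝ × ℝ)) (X : ℝ × ℝ → ℝ × ℝ) (A B ε : ℝ × ℝ → ℝ),
      (∀ w ∈ W, ε w = 1 ∨ ε w = -1) ∧
      S.IsPGChart r W X A B ∧ p ∈ X '' W ∧ S.PGRelations r W X A B ε := by
  have hdr : fderiv ℝ r p ≠ 0 := by
    intro h
    rw [orbitDrSq, h] at hk
    simp at hk
  obtain ⟨O, Y, q, hO, hq, rfl, hYV, hY, hinj, hjac, hrY⟩ := exists_chart_snd_eq hV
    (hr.contDiffOn.mono hVU) hpV hdr
  have hYU : MapsTo Y O S.U := fun z hz => hVU (hYV hz)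
  have hpos : ∀ z ∈ O, 0 < -S.orbitDet (Y z) := fun z hz => neg_pos.2 (orbitDet_neg (hYU hz))
  have hms : ContDiffOn ℝ ∞ (fun z => √(-S.orbitDet (Y z))) O :=
    (S.contDiffOn_orbitDet.comp hY hYU).neg.sqrt fun z hz => (hpos z hz).ne'
  have hjs : ContDiffOn ℝ ∞ (jac Y) O :=
    ((contDiffOn_fderiv_apply hO hY _).fst.mul (contDiffOn_fderiv_apply hO hY _).snd).sub
      ((contDiffOn_fderiv_apply hO hY _).fst.mul (contDiffOn_fderiv_apply hO hY _).snd)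
  obtain ⟨W, X, A, B, hPG, hpW, -⟩ := exists_isPGChart hr hO hq hYU hY hinj hjac hrY
    (d := fun z => jac Y z * √(-S.orbitDet (Y z)) * s (Y z))
    ((hjs.mul hms).mul (hs.comp hY hYV))
    (fun z hz => by
      rw [mul_pow, mul_pow, sq_sqrt (hpos z hz).le, ← hsq _ (hYV hz)]
      ring)
    (Or.inl (by rw [hk]; exact one_ne_zero))
  obtain ⟨ε, hε, hrel⟩ := exists_pgRelations hr hPG
  exact ⟨W, X, A, B, ε, hε, hPG, hpW, hrel⟩

end SphericalSpacetime

end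

theorem proposition3 (S : SphericalSpacetime) :
    -- the orbits have a radius of curvature
    (∃ r : ℝ × ℝ → ℝ, S.IsOrbitRadius r) ∧
    ∀ r : ℝ × ℝ → ℝ, S.IsOrbitRadius r →
      -- the Misner-Sharp energy is nonnegative where `(dr)² ≤ 1`
      (∀ x ∈ S.U, ∀ θ φ : ℝ, 0 < θ → θ < π → S.drSq r x θ φ ≤ 1 →
        0 ≤ S.misnerSharp r x θ φ) ∧
      -- curvature coordinates around every point with `dr ≠ 0` and `(dr)² < 1`
      (∀ p ∈ S.U, ∀ θ φ : ℝ, 0 < θ → θ < π → fderiv ℝ r p ≠ 0 → S.drSq r p θ φ < 1 →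
        (∃ ε : ℝ, (ε = 1 ∨ ε = -1) ∧
          ∃ (W : Set (ℝ × ℝ)) (X : ℝ × ℝ → ℝ × ℝ) (A B : ℝ × ℝ → ℝ),
            S.IsPGChart r W X A B ∧ p ∈ X '' W ∧ S.PGRelations r W X A B (fun _ => ε)) ∧
        (S.drSq r p θ φ ≠ 0 → ∀ ε : ℝ, (ε = 1 ∨ ε = -1) →
          ∃ (W : Set (ℝ × ℝ)) (X : ℝ × ℝ → ℝ × ℝ) (A B : ℝ × ℝ → ℝ),
            S.IsPGChart r W X A B ∧ p ∈ X '' W ∧ S.PGRelations r W X A B (fun _ => ε))) ∧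
      -- the same around points with `(dr)² = 1`, if `1 - (dr)²` has a smooth root nearby
      (∀ p ∈ S.U, ∀ θ φ : ℝ, 0 < θ → θ < π → S.drSq r p θ φ = 1 →
        (∃ (V : Set (ℝ × ℝ)) (s : ℝ × ℝ → ℝ), IsOpen V ∧ p ∈ V ∧ V ⊆ S.U ∧
          ContDiffOn ℝ ∞ s V ∧ ∀ x ∈ V, 1 - S.drSq r x θ φ = s x ^ 2) →
        ∃ (W : Set (ℝ × ℝ)) (X : ℝ × ℝ → ℝ × ℝ) (A B ε : ℝ × ℝ → ℝ),
          (∀ w ∈ W, ε w = 1 ∨ ε w = -1) ∧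
          S.IsPGChart r W X A B ∧ p ∈ X '' W ∧ S.PGRelations r W X A B ε) ∧
      -- the relations hold in all such coordinates
      (∀ (W : Set (ℝ × ℝ)) (X : ℝ × ℝ → ℝ × ℝ) (A B : ℝ × ℝ → ℝ), S.IsPGChart r W X A B →
        ∃ ε : ℝ × ℝ → ℝ, (∀ w ∈ W, ε w = 1 ∨ ε w = -1) ∧ S.PGRelations r W X A B ε) := by
  refine ⟨S.exists_isOrbitRadius, fun r hr => ⟨?_, ?_, ?_, ?_⟩⟩
  · intro x hx θ φ _ _ h
    exact mul_nonneg (by linarith [(hr x hx).1]) (sub_nonneg.2 h)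
  · intro p hp θ φ h0 hπ hdr hk
    rw [SphericalSpacetime.drSq_eq hp (hr.differentiableAt hp) h0 hπ] at hk ⊢
    obtain ⟨ε₀, hε₀, h⟩ := SphericalSpacetime.exists_isPGChart_of_lt_one hr hp hdr hk
    exact ⟨⟨ε₀, hε₀, h ε₀ hε₀ (Or.inr rfl)⟩, fun hne ε hε => h ε hε (Or.inl hne)⟩
  · rintro p hp θ φ h0 hπ hk ⟨V, s, hV, hpV, hVU, hs, hsq⟩
    rw [SphericalSpacetime.drSq_eq hp (hr.differentiableAt hp) h0 hπ] at hk
    refine SphericalSpacetime.exists_isPGChart_of_eq_one hr hk hV hpV hVU hs fun x hx => ?_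
    rw [← hsq x hx, SphericalSpacetime.drSq_eq (hVU hx) (hr.differentiableAt (hVU hx)) h0 hπ]
  · intro W X A B h
    exact SphericalSpacetime.exists_pgRelations hr h
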